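/- Let $n\ge 0$ and let $(M,g)$ and $(\bar M,\bar g)$ be smooth $n$-dimensional pseudo-Riemannian manifolds (metrics of arbitrary signature) with Levi-Civita connections $\nabla$ and $\bar\nabla$. A smooth vector field $\varphi$ on $(M,g)$, not identically zero, is called concircular if there is a smooth function $\varrho$ on $M$ with $g(\nabla_Y\varphi,X)=\varrho\,g(X,Y)$ for all vector fields $X,Y$; it is of the exceptional type if $\varrho\equiv 0$ and of the basic type otherwise. The manifold $(M,g)$ is an equidistant space if it admits a concircular field, and an equidistant space of the exceptional type if, moreover, all of its concircular fields are of the exceptional type. A diffeomorphism $f\colon M\to\bar M$ is a geodesic mapping of $(M,g)$ onto $(\bar M,\bar g)$ if it maps every geodesic curve of $g$ (a regular curve $\gamma$ with $\nabla_{\dot\gamma}\dot\gamma=\theta\,\dot\gamma$ for some function $\theta$, so that the parameter need not be affine) to a geodesic curve of $\bar g$. If $(M,g)$ is an equidistant space of the exceptional type and admits a geodesic mapping onto $(\bar M,\bar g)$, then $(\bar M,\bar g)$ is an equidistant space of the exceptional type. -/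

import Mathlib

open scoped Manifold ContDiff Bundle

noncomputable section

/-- A smooth pseudo-Riemannian metric (of any signature) on a smooth `n`-dimensional manifold `M`:
a smooth field of symmetric nondegenerate bilinear forms on the tangent spaces. -/
structure PseudoRiemannianMetric (n : ℕ) (M : Type*) [TopologicalSpace M]
    [ChartedSpace (EuclideanSpace ℝ (Fin n)) M] [IsManifold (𝓡 n) ∞ M] where
  /-- The bilinear form `g_x` on the tangent space at `x`. -/
  form (x : M) : TangentSpace (𝓡 n) x →L[ℝ] TangentSpace (𝓡 n) x →L[ℝ] ℝ
  symm (x : M) (v w : TangentSpace (𝓡 n) x) : form x v w = form x w v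
  nondegenerate (x : M) (v : TangentSpace (𝓡 n) x) : (∀ w, form x v w = 0) → v = 0
  contMDiff : ContMDiff (𝓡 n)
    ((𝓡 n).prod 𝓘(ℝ, EuclideanSpace ℝ (Fin n) →L[ℝ] EuclideanSpace ℝ (Fin n) →L[ℝ] ℝ)) ∞
    (fun x ↦ Bundle.TotalSpace.mk'
      (EuclideanSpace ℝ (Fin n) →L[ℝ] EuclideanSpace ℝ (Fin n) →L[ℝ] ℝ)
      (E := fun x : M ↦ TangentSpace (𝓡 n) x →L[ℝ] TangentSpace (𝓡 n) x →L[ℝ] ℝ) x (form x))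

namespace PseudoRiemannianMetric

variable {n : ℕ} {M : Type*} [TopologicalSpace M]
  [ChartedSpace (EuclideanSpace ℝ (Fin n)) M] [IsManifold (𝓡 n) ∞ M]

/-- The metric read in the chart around `p`: the bilinear form `(u, v) ↦ g(dκ u, dκ v)` on `ℝⁿ`
at the point `y`, where `κ` is the inverse of the chart (each tangent space is by
definition a copy of `ℝⁿ`). Its components in the standard basis
are the `g_ij` of the chart. -/
def inChart (g : PseudoRiemannianMetric n M) (p : M) (y : EuclideanSpace ℝ (Fin n)) :
    EuclideanSpace ℝ (Fin n) →L[ℝ] EuclideanSpace ℝ (Fin n) →L[ℝ] ℝ :=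
  let κ := (extChartAt (𝓡 n) p).symm
  let B : EuclideanSpace ℝ (Fin n) →L[ℝ] EuclideanSpace ℝ (Fin n) →L[ℝ] ℝ := g.form (κ y)
  let L : EuclideanSpace ℝ (Fin n) →L[ℝ] EuclideanSpace ℝ (Fin n) :=
    mfderiv 𝓘(ℝ, EuclideanSpace ℝ (Fin n)) (𝓡 n) κ y
  B.bilinearComp L L

/-- The Christoffel symbols of the first kind in the chart around `p`, as the linear form
`w ↦ ½ (∂_u g(v, w) + ∂_v g(u, w) - ∂_w g(u, v))` at the point `y`. -/
def christoffelFirst (g : PseudoRiemannianMetric n M) (p : M) (y u v : EuclideanSpace ℝ (Fin n)) :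
    EuclideanSpace ℝ (Fin n) →L[ℝ] ℝ :=
  let D := fderiv ℝ (g.inChart p) y
  (1 / 2 : ℝ) • (D u v + D v u - (D.flip u).flip v)

/-- The Christoffel symbols (of the second kind) of the Levi-Civita connection in the chart around
`p`: the vector `Γ(u, v)` at `y` with `g(Γ(u, v), w) = christoffelFirst g p y u v w` for all `w`,
that is, `Γ(u, v)^k = Γ^k_ij u^i v^j`. -/
def christoffel (g : PseudoRiemannianMetric n M) (p : M) (y u v : EuclideanSpace ℝ (Fin n)) :
    EuclideanSpace ℝ (Fin n) :=
  (g.inChart p y).inverse (g.christoffelFirst p y u v)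

/-- A vector field read in the chart around `p`. -/
def fieldInChart (V : (x : M) → TangentSpace (𝓡 n) x) (p : M) (y : EuclideanSpace ℝ (Fin n)) :
    EuclideanSpace ℝ (Fin n) :=
  let κ := (extChartAt (𝓡 n) p).symm
  mfderiv (𝓡 n) 𝓘(ℝ, EuclideanSpace ℝ (Fin n)) (extChartAt (𝓡 n) p) (κ y) (V (κ y))

/-- The Levi-Civita covariant derivative `∇_u V` at `x` of a vector field `V` in the direction
`u ∈ T_x M`, computed in the preferred chart at `x` (which identifies `T_x M` with `ℝⁿ`):
`(∇_u V)^k = u^i ∂_i V^k + Γ^k_ij u^i V^j`. -/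
def covDeriv (g : PseudoRiemannianMetric n M) (V : (x : M) → TangentSpace (𝓡 n) x) (x : M)
    (u : TangentSpace (𝓡 n) x) : TangentSpace (𝓡 n) x :=
  let y : EuclideanSpace ℝ (Fin n) := extChartAt (𝓡 n) x x
  let u' : EuclideanSpace ℝ (Fin n) := u
  (fderiv ℝ (fieldInChart V x) y u' + g.christoffel x y u' (V x) : EuclideanSpace ℝ (Fin n))

/-- `γ` is a geodesic curve of `g` on the open interval `J`: a regular `C²` curve along which the
covariant derivative of the velocity is everywhere proportional to the velocity,
`∇_{γ'} γ' = θ γ'` (the parameter need not be affine). At each time `t` the equation is written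
in the preferred chart at `γ t`. -/
def IsGeodesicOn (g : PseudoRiemannianMetric n M) (γ : ℝ → M) (J : Set ℝ) : Prop :=
  ContMDiffOn 𝓘(ℝ, ℝ) (𝓡 n) 2 γ J ∧
  ∀ t ∈ J,
    let c : ℝ → EuclideanSpace ℝ (Fin n) := fun s ↦ extChartAt (𝓡 n) (γ t) (γ s)
    deriv c t ≠ 0 ∧
    ∃ θ : ℝ, deriv (deriv c) t + g.christoffel (γ t) (c t) (deriv c t) (deriv c t) = θ • deriv c t

/-- The diffeomorphism `f` is a geodesic mapping: it maps every geodesic curve of `g` to a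
geodesic curve of `g'`. -/
def IsGeodesicMapping {N : Type*} [TopologicalSpace N]
    [ChartedSpace (EuclideanSpace ℝ (Fin n)) N] [IsManifold (𝓡 n) ∞ N]
    (g : PseudoRiemannianMetric n M) (g' : PseudoRiemannianMetric n N)
    (f : M ≃ₘ^∞⟮𝓡 n, 𝓡 n⟯ N) : Prop :=
  ∀ (γ : ℝ → M) (J : Set ℝ), IsOpen J → J.OrdConnected →
    g.IsGeodesicOn γ J → g'.IsGeodesicOn (fun t ↦ f (γ t)) J

/-- The smooth vector field `φ` is concircular with the scalar field `ρ`: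
`g(∇_Y φ, X) = ρ g(X, Y)` for all tangent vectors `X, Y`. -/
def IsConcircular (g : PseudoRiemannianMetric n M) (φ : (x : M) → TangentSpace (𝓡 n) x)
    (ρ : M → ℝ) : Prop :=
  ContMDiff (𝓡 n) (𝓡 n).tangent ∞ (fun x ↦ (⟨x, φ x⟩ : TangentBundle (𝓡 n) M)) ∧
  ContMDiff (𝓡 n) 𝓘(ℝ, ℝ) ∞ ρ ∧
  ∀ (x : M) (X Y : TangentSpace (𝓡 n) x), g.form x (g.covDeriv φ x Y) X = ρ x * g.form x X Y

/-- `(M, g)` is an equidistant space: it admits a (not identically zero) concircular field. -/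
def IsEquidistant (g : PseudoRiemannianMetric n M) : Prop :=
  ∃ (φ : (x : M) → TangentSpace (𝓡 n) x) (ρ : M → ℝ), (∃ x, φ x ≠ 0) ∧ g.IsConcircular φ ρ

/-- `(M, g)` is an equidistant space of the exceptional type: it admits a concircular field, and
all of its concircular fields are of the exceptional type, that is, have `ρ = 0`. -/
def IsExceptionalEquidistant (g : PseudoRiemannianMetric n M) : Prop :=
  g.IsEquidistant ∧
  ∀ (φ : (x : M) → TangentSpace (𝓡 n) x) (ρ : M → ℝ), (∃ x, φ x ≠ 0) → g.IsConcircular φ ρ →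
    ∀ x, ρ x = 0

end PseudoRiemannianMetric

end

noncomputable section

/-!
Every short geodesic arc is mapped to a geodesic curve, so the quadratic map `v ↦ P(v, v)` given by
the difference `P` of the two Levi-Civita connections multiplies each vector by a scalar, and
therefore `P = ψ ⊗ id + id ⊗ ψ` for a one-form `ψ`. With `H` the second metric carried over to the
first manifold and `s = |det (H⁻¹ G)| ^ (-1 / (n + 1))`, the endomorphism field `a = s H⁻¹ G` then
solves the Sinyukov equation `∇_v a x = G(l, x) v + G(x, v) l` with `l = grad (½ tr a)`, and
`ψ ∘ a = -G(l, ·)`. Moreover `V ↦ s ^ (-1/2) V` is a bijection between the concircular fields of the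
two metrics, and the covariant differentials differ, up to the factor `s ^ (-1/2)`, by `ψ(V) id`. It
thus suffices to show `ψ(V) = 0` for every concircular, hence parallel, field `V` of `G`.

The integrability conditions of the Sinyukov equation make `l` concircular, hence parallel, where
`V ≠ 0`. By induction on `k`, `G(a ^ k V, l) = 0`: granted this for smaller exponents, the field
`2 G(a ^ k V, l) a V - G(a ^ (k + 1) V, V) l` is concircular with the factor
`2 G(a ^ k V, l) G(V, l)`, so it is parallel. This factor therefore vanishes, which settles `k = 0`,
and for `k > 0` the induction hypothesis for this field and for `l` gives `G(a ^ k V, l) ^ 2 = 0`.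
As `ψ ∘ a = -G(l, ·)`, the form `ψ` vanishes on all `a ^ (k + 1) V`, and hence on `V` because the
invertible endomorphism `a` is annihilated by a polynomial with nonzero constant term.
-/

open Topology Filter IsManifold

set_option maxSynthPendingDepth 3

namespace GeodesicMapping

/-! ### The Levi-Civita connection of a metric on an open set -/

section LeviCivita

variable {E : Type*} [NormedAddCommGroup E] [NormedSpace ℝ E]
  {F : Type*} [NormedAddCommGroup F] [NormedSpace ℝ F]

lemma isSymmSndFDerivAt_of_smooth {f : E → F} {y : E} (hf : ContDiffAt ℝ ∞ f y) :
    IsSymmSndFDerivAt ℝ f y :=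
  hf.isSymmSndFDerivAt (by simpa using WithTop.coe_le_coe.2 (le_top : (2 : ℕ∞) ≤ ⊤))

/-- A scalar product of arbitrary signature: a symmetric nondegenerate bilinear form. -/
structure IsMetricForm (B : E →L[ℝ] E →L[ℝ] ℝ) : Prop where
  symm (v w : E) : B v w = B w v
  nondegenerate (v : E) : (∀ w, B v w = 0) → v = 0

namespace IsMetricForm

variable {B : E →L[ℝ] E →L[ℝ] ℝ}

lemma ext (hB : IsMetricForm B) {u v : E} (h : ∀ w, B u w = B v w) : u = v :=
  sub_eq_zero.1 (hB.nondegenerate _ fun w ↦ by rw [map_sub, sub_apply, h w, sub_self])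

lemma bilinearComp (hB : IsMetricForm B) {L : F →L[ℝ] E} (hL : L.IsInvertible) :
    IsMetricForm (B.bilinearComp L L) := by
  obtain ⟨e, rfl⟩ := hL
  refine ⟨fun v w ↦ hB.symm (e v) (e w), fun v hv ↦ e.map_eq_zero_iff.1 ?_⟩
  exact hB.nondegenerate _ fun w ↦ by simpa using hv (e.symm w)

variable [FiniteDimensional ℝ E]

lemma isInvertible (hB : IsMetricForm B) : B.IsInvertible := by
  have hinj : Function.Injective (B : E →ₗ[ℝ] E →L[ℝ] ℝ) := fun u v h ↦
    hB.ext fun w ↦ DFunLike.congr_fun h w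
  have hrank : Module.finrank ℝ E = Module.finrank ℝ (E →L[ℝ] ℝ) := by
    rw [← (LinearMap.toContinuousLinearMap : (E →ₗ[ℝ] ℝ) ≃ₗ[ℝ] E →L[ℝ] ℝ).finrank_eq]
    exact (Subspace.dual_finrank_eq (K := ℝ) (V := E)).symm
  exact ⟨(LinearEquiv.ofInjectiveOfFinrankEq (B : E →ₗ[ℝ] E →L[ℝ] ℝ) hinj
    hrank).toContinuousLinearEquiv, rfl⟩

lemma apply_inverse (hB : IsMetricForm B) (ℓ : E →L[ℝ] ℝ) : B (B.inverse ℓ) = ℓ := by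
  obtain ⟨e, rfl⟩ := hB.isInvertible
  simp

end IsMetricForm

/-- A smooth pseudo-Riemannian metric on the open subset `Ω` of the vector space `E`; the values of
`G` outside `Ω` are irrelevant. -/
structure IsMetricOn (G : E → E →L[ℝ] E →L[ℝ] ℝ) (Ω : Set E) : Prop where
  isOpen : IsOpen Ω
  contDiffOn : ContDiffOn ℝ ∞ G Ω
  isMetricForm (y : E) (hy : y ∈ Ω) : IsMetricForm (G y)

/-- The Christoffel symbols of the first kind, as a bilinear map: the linear forms
`w ↦ ½ (∂_u G(v, w) + ∂_v G(u, w) - ∂_w G(u, v))` depending bilinearly on `u` and `v`. -/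
def koszulForm (G : E → E →L[ℝ] E →L[ℝ] ℝ) (y : E) : E →L[ℝ] E →L[ℝ] E →L[ℝ] ℝ :=
  let D := fderiv ℝ G y
  (1 / 2 : ℝ) • (D + D.flip -
    (ContinuousLinearMap.flipₗᵢ ℝ E E ℝ).toContinuousLinearEquiv.toContinuousLinearMap.comp D.flip)

/-- The Christoffel symbols of the second kind at `y`, as a bilinear map. -/
def leviCivita (G : E → E →L[ℝ] E →L[ℝ] ℝ) (y : E) : E →L[ℝ] E →L[ℝ] E :=
  (ContinuousLinearMap.compL ℝ E (E →L[ℝ] ℝ) E (G y).inverse).comp (koszulForm G y)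

/-- The covariant differential `u ↦ ∇_u V` at `y` of the vector field `V`. -/
def cov (G : E → E →L[ℝ] E →L[ℝ] ℝ) (V : E → E) (y : E) : E →L[ℝ] E :=
  fderiv ℝ V y + (leviCivita G y).flip (V y)

lemma koszulForm_apply (G : E → E →L[ℝ] E →L[ℝ] ℝ) (y u v w : E) : koszulForm G y u v w =
    (1 / 2 : ℝ) * (fderiv ℝ G y u v w + fderiv ℝ G y v u w - fderiv ℝ G y w u v) := rfl

lemma cov_apply (G : E → E →L[ℝ] E →L[ℝ] ℝ) (V : E → E) (y u : E) :
    cov G V y u = fderiv ℝ V y u + leviCivita G y u (V y) := rfl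

lemma leviCivita_congr {G H : E → E →L[ℝ] E →L[ℝ] ℝ} {y : E} (h : G =ᶠ[𝓝 y] H) :
    leviCivita G y = leviCivita H y := by
  rw [leviCivita, leviCivita, koszulForm, koszulForm, h.fderiv_eq, h.self_of_nhds]

lemma cov_congr {G : E → E →L[ℝ] E →L[ℝ] ℝ} {V W : E → E} {y : E} (h : V =ᶠ[𝓝 y] W) :
    cov G V y = cov G W y := by
  rw [cov, cov, h.fderiv_eq, h.self_of_nhds]

namespace IsMetricOn

variable {G : E → E →L[ℝ] E →L[ℝ] ℝ} {Ω : Set E} {y : E}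

lemma contDiffAt (hG : IsMetricOn G Ω) (hy : y ∈ Ω) : ContDiffAt ℝ ∞ G y :=
  hG.contDiffOn.contDiffAt (hG.isOpen.mem_nhds hy)

lemma differentiableAt (hG : IsMetricOn G Ω) (hy : y ∈ Ω) : DifferentiableAt ℝ G y :=
  (hG.contDiffAt hy).differentiableAt (by simp)

lemma fderiv_apply₂ (hG : IsMetricOn G Ω) (hy : y ∈ Ω) (u v w : E) :
    fderiv ℝ G y u v w = fderiv ℝ (fun z ↦ G z v w) y u := by
  have hder := ((hG.differentiableAt hy).hasFDerivAt.clm_apply (hasFDerivAt_const v y)).clm_apply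
    (hasFDerivAt_const w y)
  rw [hder.fderiv]
  simp

lemma fderiv_symm (hG : IsMetricOn G Ω) (hy : y ∈ Ω) (u v w : E) :
    fderiv ℝ G y u v w = fderiv ℝ G y u w v := by
  rw [hG.fderiv_apply₂ hy, hG.fderiv_apply₂ hy]
  congr 1
  refine Filter.EventuallyEq.fderiv_eq ?_
  filter_upwards [hG.isOpen.mem_nhds hy] with z hz using (hG.isMetricForm z hz).symm v w

variable [FiniteDimensional ℝ E]

lemma contDiffAt_leviCivita (hG : IsMetricOn G Ω) (hy : y ∈ Ω) :
    ContDiffAt ℝ ∞ (leviCivita G) y := by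
  have hD : ContDiffAt ℝ ∞ (fderiv ℝ G) y := (hG.contDiffAt hy).fderiv_right (m := ∞) (by simp)
  have hflip : ContDiffAt ℝ ∞ (fun z ↦ (fderiv ℝ G z).flip) y :=
    (ContinuousLinearMap.flipₗᵢ ℝ E E (E →L[ℝ] ℝ)).contDiff.contDiffAt.comp y hD
  have hkoszul : ContDiffAt ℝ ∞ (koszulForm G) y :=
    ((hD.add hflip).sub (contDiffAt_const.clm_comp hflip)).const_smul (1 / 2 : ℝ)
  have hinverse : ContDiffAt ℝ ∞ (fun z ↦ (G z).inverse) y :=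
    ((hG.isMetricForm y hy).isInvertible.contDiffAt_map_inverse (n := ∞)).comp y (hG.contDiffAt hy)
  exact ((ContinuousLinearMap.compL ℝ E (E →L[ℝ] ℝ) E).contDiff.contDiffAt.comp y
    hinverse).clm_comp hkoszul

lemma apply_leviCivita (hG : IsMetricOn G Ω) (hy : y ∈ Ω) (u v w : E) :
    G y (leviCivita G y u v) w =
      (1 / 2 : ℝ) * (fderiv ℝ G y u v w + fderiv ℝ G y v u w - fderiv ℝ G y w u v) := by
  rw [← koszulForm_apply, ← (hG.isMetricForm y hy).apply_inverse (koszulForm G y u v)]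
  rfl

lemma leviCivita_symm (hG : IsMetricOn G Ω) (hy : y ∈ Ω) (u v : E) :
    leviCivita G y u v = leviCivita G y v u := by
  refine (hG.isMetricForm y hy).ext fun w ↦ ?_
  rw [hG.apply_leviCivita hy, hG.apply_leviCivita hy, hG.fderiv_symm hy w u v]
  ring

lemma fderiv_eq_leviCivita (hG : IsMetricOn G Ω) (hy : y ∈ Ω) (u v w : E) :
    fderiv ℝ G y u v w = G y (leviCivita G y u v) w + G y v (leviCivita G y u w) := by
  rw [(hG.isMetricForm y hy).symm v, hG.apply_leviCivita hy, hG.apply_leviCivita hy,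
    hG.fderiv_symm hy u w v]
  ring

lemma fderiv_apply_apply (hG : IsMetricOn G Ω) (hy : y ∈ Ω) {V W : E → E}
    (hV : DifferentiableAt ℝ V y) (hW : DifferentiableAt ℝ W y) (u : E) :
    fderiv ℝ (fun z ↦ G z (V z) (W z)) y u = G y (cov G V y u) (W y) + G y (V y) (cov G W y u) := by
  rw [(((hG.differentiableAt hy).hasFDerivAt.clm_apply hV.hasFDerivAt).clm_apply
    hW.hasFDerivAt).fderiv]
  simp only [cov_apply, map_add, add_apply, ContinuousLinearMap.comp_apply,
    ContinuousLinearMap.flip_apply, hG.fderiv_eq_leviCivita hy]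
  ring

end IsMetricOn

section CovRules

variable {G : E → E →L[ℝ] E →L[ℝ] ℝ} {V W : E → E} {f : E → ℝ} {y : E}

lemma cov_zero : cov G (fun _ ↦ 0) y = 0 := by
  ext u
  simp [cov_apply]

lemma cov_smul (hf : DifferentiableAt ℝ f y) (hV : DifferentiableAt ℝ V y) (u : E) :
    cov G (fun z ↦ f z • V z) y u = f y • cov G V y u + fderiv ℝ f y u • V y := by
  rw [cov_apply, cov_apply, fderiv_fun_smul hf hV]
  simp only [add_apply, smul_apply, ContinuousLinearMap.smulRight_apply, map_smul]
  module

lemma cov_add (hV : DifferentiableAt ℝ V y) (hW : DifferentiableAt ℝ W y) (u : E) :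
    cov G (fun z ↦ V z + W z) y u = cov G V y u + cov G W y u := by
  rw [cov_apply, cov_apply, cov_apply, fderiv_fun_add hV hW]
  simp only [add_apply, map_add]
  abel

lemma cov_sub (hV : DifferentiableAt ℝ V y) (hW : DifferentiableAt ℝ W y) (u : E) :
    cov G (fun z ↦ V z - W z) y u = cov G V y u - cov G W y u := by
  rw [cov_apply, cov_apply, cov_apply, fderiv_fun_sub hV hW]
  simp only [sub_apply, map_sub]
  abel

end CovRules

/-- `τ` is a local isometry at `y` from the metric `G` to the metric `G'`. -/
structure IsIsometryAt (G : E → E →L[ℝ] E →L[ℝ] ℝ) (G' : F → F →L[ℝ] F →L[ℝ] ℝ) (τ : E → F)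
    (y : E) : Prop where
  contDiffAt : ContDiffAt ℝ ∞ τ y
  isInvertible : (fderiv ℝ τ y).IsInvertible
  eventually_eq : ∀ᶠ z in 𝓝 y, G z = (G' (τ z)).bilinearComp (fderiv ℝ τ z) (fderiv ℝ τ z)

namespace IsIsometryAt

variable {G : E → E →L[ℝ] E →L[ℝ] ℝ} {G' : F → F →L[ℝ] F →L[ℝ] ℝ} {Ω : Set E} {Ω' : Set F}
  {y : E} {τ : E → F}

lemma differentiableAt (h : IsIsometryAt G G' τ y) : DifferentiableAt ℝ τ y :=
  h.contDiffAt.differentiableAt (by simp)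

lemma differentiableAt_fderiv (h : IsIsometryAt G G' τ y) :
    DifferentiableAt ℝ (fderiv ℝ τ) y :=
  (h.contDiffAt.fderiv_right (m := ∞) (by simp)).differentiableAt (by simp)

lemma apply_map (h : IsIsometryAt G G' τ y) (u v : E) :
    G' (τ y) (fderiv ℝ τ y u) (fderiv ℝ τ y v) = G y u v := by
  rw [h.eventually_eq.self_of_nhds]
  rfl

lemma fderiv_metric (h : IsIsometryAt G G' τ y) (hG : IsMetricOn G Ω) (hy : y ∈ Ω)
    (hG' : IsMetricOn G' Ω') (hτy : τ y ∈ Ω') (u v w : E) :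
    fderiv ℝ G y u v w =
      fderiv ℝ G' (τ y) (fderiv ℝ τ y u) (fderiv ℝ τ y v) (fderiv ℝ τ y w)
      + G' (τ y) (fderiv ℝ (fderiv ℝ τ) y u v) (fderiv ℝ τ y w)
      + G' (τ y) (fderiv ℝ τ y v) (fderiv ℝ (fderiv ℝ τ) y u w) := by
  have hpull : (fun z ↦ G z v w) =ᶠ[𝓝 y]
      fun z ↦ (G' (τ z)) (fderiv ℝ τ z v) (fderiv ℝ τ z w) := by
    filter_upwards [h.eventually_eq] with z hz
    rw [hz]
    rfl
  have hG'τ : HasFDerivAt (fun z ↦ G' (τ z)) _ y :=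
    (hG'.differentiableAt hτy).hasFDerivAt.comp y h.differentiableAt.hasFDerivAt
  have hτ' := h.differentiableAt_fderiv.hasFDerivAt
  have hder := (hG'τ.clm_apply (hτ'.clm_apply (hasFDerivAt_const v y))).clm_apply
    (hτ'.clm_apply (hasFDerivAt_const w y))
  rw [hG.fderiv_apply₂ hy, hpull.fderiv_eq, hder.fderiv]
  simp only [add_apply, ContinuousLinearMap.comp_apply, ContinuousLinearMap.flip_apply, zero_apply,
    map_zero, zero_add]
  ring

variable [FiniteDimensional ℝ E] [FiniteDimensional ℝ F]

lemma map_leviCivita (h : IsIsometryAt G G' τ y) (hG : IsMetricOn G Ω) (hy : y ∈ Ω)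
    (hG' : IsMetricOn G' Ω') (hτy : τ y ∈ Ω') (u v : E) :
    fderiv ℝ τ y (leviCivita G y u v) =
      leviCivita G' (τ y) (fderiv ℝ τ y u) (fderiv ℝ τ y v) + fderiv ℝ (fderiv ℝ τ) y u v := by
  have hsymm : ∀ u v, fderiv ℝ (fderiv ℝ τ) y u v = fderiv ℝ (fderiv ℝ τ) y v u :=
    (isSymmSndFDerivAt_of_smooth h.contDiffAt).eq
  refine (hG'.isMetricForm _ hτy).ext fun w' ↦ ?_
  obtain ⟨w, rfl⟩ := h.isInvertible.surjective w'
  have hG'symm := (hG'.isMetricForm _ hτy).symm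
  have hder := h.fderiv_metric hG hy hG' hτy
  rw [h.apply_map, hG.apply_leviCivita hy, map_add, add_apply,
    hG'.apply_leviCivita hτy, hder, hder, hder, hsymm v u, hsymm w u, hsymm w v,
    hG'symm (fderiv ℝ τ y v), hG'symm (fderiv ℝ τ y u)]
  ring

lemma map_cov (h : IsIsometryAt G G' τ y) (hG : IsMetricOn G Ω) (hy : y ∈ Ω)
    (hG' : IsMetricOn G' Ω') (hτy : τ y ∈ Ω') {V : E → E} {V' : F → F}
    (hV : DifferentiableAt ℝ V y) (hV' : DifferentiableAt ℝ V' (τ y))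
    (hVV' : ∀ᶠ z in 𝓝 y, V' (τ z) = fderiv ℝ τ z (V z)) (u : E) :
    fderiv ℝ τ y (cov G V y u) = cov G' V' (τ y) (fderiv ℝ τ y u) := by
  have hleft := hV'.hasFDerivAt.comp y h.differentiableAt.hasFDerivAt
  have hright := h.differentiableAt_fderiv.hasFDerivAt.clm_apply hV.hasFDerivAt
  have hder := DFunLike.congr_fun (hleft.unique (hright.congr_of_eventuallyEq hVV')) u
  simp only [ContinuousLinearMap.comp_apply, add_apply, ContinuousLinearMap.flip_apply] at hder
  rw [cov_apply, cov_apply, map_add, h.map_leviCivita hG hy hG' hτy, hder, hVV'.self_of_nhds]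
  abel

lemma map_acceleration {c : ℝ → E} {t : ℝ} (h : IsIsometryAt G G' τ (c t)) (hG : IsMetricOn G Ω)
    (hy : c t ∈ Ω) (hG' : IsMetricOn G' Ω') (hτy : τ (c t) ∈ Ω')
    (hc : ContDiffAt ℝ 2 c t) :
    deriv (fun s ↦ τ (c s)) t = fderiv ℝ τ (c t) (deriv c t) ∧
    deriv (deriv fun s ↦ τ (c s)) t + leviCivita G' (τ (c t)) (deriv (fun s ↦ τ (c s)) t)
        (deriv (fun s ↦ τ (c s)) t) =
      fderiv ℝ τ (c t) (deriv (deriv c) t + leviCivita G (c t) (deriv c t) (deriv c t)) := by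
  have hc₀ : DifferentiableAt ℝ c t := hc.differentiableAt (by simp)
  have hc' : DifferentiableAt ℝ (deriv c) t :=
    ((hc.fderiv_right (m := 1) (by norm_num)).clm_apply contDiffAt_const).differentiableAt (by simp)
  have hvelocity : ∀ᶠ s in 𝓝 t, deriv (fun s ↦ τ (c s)) s = fderiv ℝ τ (c s) (deriv c s) := by
    filter_upwards [hc₀.continuousAt.eventually
      ((h.contDiffAt.of_le (by simp : (1 : WithTop ℕ∞) ≤ ∞)).eventually (by simp)),
      hc.eventually (by simp)] with s hτ hc
    exact ((hτ.differentiableAt (by simp)).hasFDerivAt.comp_hasDerivAt s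
      (hc.differentiableAt (by simp)).hasDerivAt).deriv
  have hacceleration := ((h.differentiableAt_fderiv.hasFDerivAt.comp_hasDerivAt t
    hc₀.hasDerivAt).clm_apply hc'.hasDerivAt).congr_of_eventuallyEq hvelocity
  refine ⟨hvelocity.self_of_nhds, ?_⟩
  rw [hacceleration.deriv, hvelocity.self_of_nhds, map_add, h.map_leviCivita hG hy hG' hτy]
  simp only [Function.comp_def]
  abel

end IsIsometryAt

end LeviCivita

/-! ### Geodesics and parallel fields -/

section ProportionalDiagonal

variable {E : Type*} [NormedAddCommGroup E] [NormedSpace ℝ E] {S : E →L[ℝ] E →L[ℝ] E} {θ : E → ℝ}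

lemma eigenvalue_smul (hθ : ∀ v, S v v = θ v • v) (hθ₀ : θ 0 = 0) (c : ℝ) (v : E) :
    θ (c • v) = c * θ v := by
  rcases eq_or_ne v 0 with rfl | hv
  · simp [hθ₀]
  rcases eq_or_ne c 0 with rfl | hc
  · simp [hθ₀]
  have hcv := hθ (c • v)
  rw [map_smul, map_smul, smul_apply, hθ v, smul_smul, smul_smul, smul_smul] at hcv
  have hcancel : c * (θ (c • v) - c * θ v) = 0 := by
    linear_combination -smul_left_injective ℝ hv hcv
  exact sub_eq_zero.1 ((mul_eq_zero.1 hcancel).resolve_left hc)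

lemma eigenvalue_add (hS : ∀ u v, S u v = S v u) (hθ : ∀ v, S v v = θ v • v) (hθ₀ : θ 0 = 0)
    (u v : E) : θ (u + v) = θ u + θ v := by
  rcases eq_or_ne v 0 with rfl | hv
  · simp [hθ₀]
  by_cases hli : LinearIndependent ℝ ![v, u]
  · have hparallelogram : (2 * θ v - θ (u + v) + θ (u - v)) • v
        + (2 * θ u - θ (u + v) - θ (u - v)) • u = 0 := by
      have hadd := hθ (u + v)
      have hsub := hθ (u - v)
      simp only [map_add, map_sub, add_apply, sub_apply, hS v u, hθ u, hθ v] at hadd hsub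
      linear_combination (norm := module) hadd + hsub
    obtain ⟨hv, hu⟩ := LinearIndependent.pair_iff.1 hli _ _ hparallelogram
    linarith
  · rw [LinearIndependent.pair_iff' hv] at hli
    push Not at hli
    obtain ⟨a, rfl⟩ := hli
    have hsmul : a • v + v = (a + 1) • v := by module
    rw [hsmul, eigenvalue_smul hθ hθ₀, eigenvalue_smul hθ hθ₀]
    ring

lemma exists_eq_smul_add_smul [FiniteDimensional ℝ E] (hS : ∀ u v, S u v = S v u)
    (h : ∀ v, ∃ θ : ℝ, S v v = θ • v) :
    ∃ ψ : E →L[ℝ] ℝ, ∀ u v, S u v = ψ u • v + ψ v • u := by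
  have hnormalized : ∀ v, ∃ θ : ℝ, S v v = θ • v ∧ (v = 0 → θ = 0) := fun v ↦ by
    rcases eq_or_ne v 0 with rfl | hv
    · exact ⟨0, by simp, fun _ ↦ rfl⟩
    · exact (h v).imp fun θ hθ ↦ ⟨hθ, fun hv₀ ↦ absurd hv₀ hv⟩
  choose θ hθ hθ₀ using hnormalized
  let ℓ : E →ₗ[ℝ] ℝ :=
    { toFun := θ
      map_add' := eigenvalue_add hS hθ (hθ₀ 0 rfl)
      map_smul' := eigenvalue_smul hθ (hθ₀ 0 rfl) }
  refine ⟨(1 / 2 : ℝ) • LinearMap.toContinuousLinearMap ℓ, fun u v ↦ ?_⟩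
  have hpolar := hθ (u + v)
  simp only [map_add, add_apply, hS v u, hθ u, hθ v, eigenvalue_add hS hθ (hθ₀ 0 rfl)] at hpolar
  change S u v = ((1 / 2 : ℝ) * θ u) • v + ((1 / 2 : ℝ) * θ v) • u
  linear_combination (norm := module) (1 / 2 : ℝ) • hpolar

end ProportionalDiagonal

section Connection

variable {E : Type*} [NormedAddCommGroup E] [NormedSpace ℝ E]

lemma hasDerivAt_segment_of_cov_eq_zero {G : E → E →L[ℝ] E →L[ℝ] ℝ} {φ : E → E} {x w : E} {t : ℝ}
    (hφ : DifferentiableAt ℝ φ (x + t • w)) (hcov : cov G φ (x + t • w) = 0) :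
    HasDerivAt (fun s : ℝ ↦ φ (x + s • w)) (-leviCivita G (x + t • w) w (φ (x + t • w))) t := by
  have hline : HasDerivAt (fun s : ℝ ↦ x + s • w) w t := by
    simpa using ((hasDerivAt_id t).smul_const w).const_add x
  have hparallel := DFunLike.congr_fun hcov w
  rw [cov_apply, zero_apply] at hparallel
  exact eq_neg_of_add_eq_zero_left hparallel ▸ hφ.hasFDerivAt.comp_hasDerivAt t hline

/-- The vector field on the tangent bundle of an open subset of `E` whose integral curves are the
affinely parametrized geodesics together with their velocities. -/
def geodesicSpray (G : E → E →L[ℝ] E →L[ℝ] ℝ) (z : E × E) : E × E :=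
  (z.2, -leviCivita G z.1 z.2 z.2)

namespace IsMetricOn

variable [FiniteDimensional ℝ E] {G : E → E →L[ℝ] E →L[ℝ] ℝ} {Ω : Set E} {y : E}

lemma contDiffAt_geodesicSpray (hG : IsMetricOn G Ω) (hy : y ∈ Ω) (v : E) :
    ContDiffAt ℝ ∞ (geodesicSpray G) (y, v) := by
  have hΓ : ContDiffAt ℝ ∞ (fun z : E × E ↦ leviCivita G z.1) (y, v) :=
    ContDiffAt.comp (y, v) (hG.contDiffAt_leviCivita hy) contDiffAt_fst
  exact contDiffAt_snd.prodMk ((hΓ.clm_apply contDiffAt_snd).clm_apply contDiffAt_snd).neg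

lemma exists_integralCurve_geodesicSpray (hG : IsMetricOn G Ω) (hy : y ∈ Ω) {v : E} (hv : v ≠ 0) :
    ∃ α : ℝ → E × E, α 0 = (y, v) ∧ ∃ ε > 0, ∀ t ∈ Set.Icc (-ε) ε,
      (α t).1 ∈ Ω ∧ (α t).2 ≠ 0 ∧ HasDerivAt α (geodesicSpray G (α t)) t := by
  obtain ⟨α, hα₀, r, hr, hα⟩ :=
    (((hG.contDiffAt_geodesicSpray hy v).of_le (by simp)
      ).exists_forall_mem_closedBall_exists_eq_forall_mem_Ioo_hasDerivAt₀ 0)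
  simp only [zero_sub, zero_add] at hα
  have hzero : (0 : ℝ) ∈ Set.Ioo (-r) r := ⟨neg_lt_zero.2 hr, hr⟩
  have hcont : ContinuousAt α 0 := (hα 0 hzero).continuousAt
  have hev : ∀ᶠ t in 𝓝 (0 : ℝ),
      (α t).1 ∈ Ω ∧ (α t).2 ≠ 0 ∧ HasDerivAt α (geodesicSpray G (α t)) t := by
    filter_upwards [hcont.fst.eventually_mem (hG.isOpen.mem_nhds (by rwa [hα₀])),
      hcont.snd.eventually_ne (by rwa [hα₀]), isOpen_Ioo.mem_nhds hzero] with t hΩ hne ht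
    exact ⟨hΩ, hne, hα t ht⟩
  obtain ⟨ε, hε, hball⟩ := Metric.nhds_basis_closedBall.eventually_iff.1 hev
  refine ⟨α, hα₀, ε, hε, fun t ht ↦ hball ?_⟩
  rwa [Real.closedBall_eq_Icc, zero_sub, zero_add]

lemma exists_geodesic (hG : IsMetricOn G Ω) (hy : y ∈ Ω) {v : E} (hv : v ≠ 0) :
    ∃ c : ℝ → E, c 0 = y ∧ deriv c 0 = v ∧ ∃ ε > 0, ContDiffOn ℝ 2 c (Set.Ioo (-ε) ε) ∧
      ∀ t ∈ Set.Ioo (-ε) ε, c t ∈ Ω ∧ deriv c t ≠ 0 ∧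
        deriv (deriv c) t + leviCivita G (c t) (deriv c t) (deriv c t) = 0 := by
  obtain ⟨α, hα₀, ε, hε, hα⟩ := hG.exists_integralCurve_geodesicSpray hy hv
  have hvelocity : ∀ t ∈ Set.Icc (-ε) ε, deriv (fun s ↦ (α s).1) t = (α t).2 :=
    fun t ht ↦ HasDerivAt.deriv (hα t ht).2.2.fst
  have hsmooth : ContDiffOn ℝ ((⊤ : ℕ∞) : WithTop ℕ∞) α (Set.Icc (-ε) ε) :=
    ODE.contDiffOn_enat_Icc_of_hasDerivWithinAt (f := fun _ ↦ geodesicSpray G)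
      (u := Ω ×ˢ Set.univ)
      (fun z hz ↦ ((hG.contDiffAt_geodesicSpray hz.2.1 z.2.2).comp z
        contDiffAt_snd).contDiffWithinAt)
      (fun t ht ↦ (hα t ht).2.2.hasDerivWithinAt) fun t ht ↦ ⟨(hα t ht).1, trivial⟩
  have hzero : (0 : ℝ) ∈ Set.Icc (-ε) ε := ⟨by linarith, by linarith⟩
  refine ⟨fun s ↦ (α s).1, congrArg Prod.fst hα₀, by rw [hvelocity 0 hzero, hα₀], ε, hε, ?_,
    fun t ht ↦ ?_⟩
  · exact (contDiff_fst.comp_contDiffOn (hsmooth.mono Set.Ioo_subset_Icc_self)).of_le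
      (WithTop.coe_le_coe.2 le_top)
  · have htc := Set.Ioo_subset_Icc_self ht
    have hevent : deriv (fun s ↦ (α s).1) =ᶠ[𝓝 t] fun s ↦ (α s).2 := by
      filter_upwards [isOpen_Ioo.mem_nhds ht] with s hs using
        hvelocity s (Set.Ioo_subset_Icc_self hs)
    have hacceleration : deriv (deriv fun s ↦ (α s).1) t = -leviCivita G (α t).1 (α t).2 (α t).2 :=
      hevent.deriv_eq.trans (HasDerivAt.deriv (hα t htc).2.2.snd)
    rw [hacceleration, hvelocity t htc, neg_add_cancel]
    exact ⟨(hα t htc).1, (hα t htc).2.1, rfl⟩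

lemma eventually_eq_zero_of_cov_eq_zero (hG : IsMetricOn G Ω) (hy : y ∈ Ω) {φ : E → E}
    (hφ : ∀ z ∈ Ω, DifferentiableAt ℝ φ z) (hcov : ∀ z ∈ Ω, cov G φ z = 0) (h₀ : φ y = 0) :
    ∀ᶠ z in 𝓝 y, φ z = 0 := by
  set K := ‖leviCivita G y‖ + 1
  have hK : ∀ᶠ z in 𝓝 y, ‖leviCivita G z‖ < K :=
    (hG.contDiffAt_leviCivita hy).continuousAt.norm.eventually_lt_const (lt_add_one _)
  obtain ⟨r, hr, hball⟩ := Metric.eventually_nhds_iff_ball.1 (hK.and (hG.isOpen.mem_nhds hy))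
  filter_upwards [Metric.ball_mem_nhds y hr] with z hz
  have hsegment : ∀ t ∈ Set.Icc (0 : ℝ) 1, y + t • (z - y) ∈ Metric.ball y r := fun t ht ↦
    (convex_ball y r).add_smul_sub_mem (Metric.mem_ball_self hr) hz ht
  have hderiv : ∀ t ∈ Set.Icc (0 : ℝ) 1, HasDerivAt (fun s : ℝ ↦ φ (y + s • (z - y)))
      (-leviCivita G (y + t • (z - y)) (z - y) (φ (y + t • (z - y)))) t := fun t ht ↦
    have hΩ := (hball _ (hsegment t ht)).2
    hasDerivAt_segment_of_cov_eq_zero (hφ _ hΩ) (hcov _ hΩ)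
  have hgronwall := eq_zero_of_abs_deriv_le_mul_abs_self_of_eq_zero_right (K := K * ‖z - y‖)
    (fun t ht ↦ (hderiv t ht).continuousAt.continuousWithinAt)
    (fun t ht ↦ (hderiv t (Set.Ico_subset_Icc_self ht)).hasDerivWithinAt) (by simpa using h₀)
    (fun t ht ↦ by
      rw [norm_neg]
      refine (ContinuousLinearMap.le_opNorm₂ _ _ _).trans ?_
      have := (hball _ (hsegment t (Set.Ico_subset_Icc_self ht))).1.le
      gcongr) 1 (Set.right_mem_Icc.2 zero_le_one)
  simpa using hgronwall

end IsMetricOn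

end Connection

/-! ### The Sinyukov equation -/

section TraceDet

/-- The trace of an endomorphism, as a continuous linear form. -/
def traceL (E : Type*) [NormedAddCommGroup E] [NormedSpace ℝ E] [FiniteDimensional ℝ E] :
    (E →L[ℝ] E) →L[ℝ] ℝ :=
  LinearMap.toContinuousLinearMap ((LinearMap.trace ℝ E).comp (ContinuousLinearMap.coeLM ℝ))

variable {E : Type*} [NormedAddCommGroup E] [NormedSpace ℝ E]

lemma det_ne_zero_of_isInvertible {A : E →L[ℝ] E} (hA : A.IsInvertible) : A.det ≠ 0 := by
  obtain ⟨e, rfl⟩ := hA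
  exact (LinearEquiv.isUnit_det' e.toLinearEquiv).ne_zero

variable [FiniteDimensional ℝ E]

lemma traceL_comp_comm (A B : E →L[ℝ] E) : traceL E (A.comp B) = traceL E (B.comp A) :=
  LinearMap.trace_comp_comm' (B : E →ₗ[ℝ] E) (A : E →ₗ[ℝ] E)

lemma traceL_id : traceL E (.id ℝ E) = Module.finrank ℝ E := LinearMap.trace_id ℝ E

lemma traceL_smulRight (α : E →L[ℝ] ℝ) (v : E) : traceL E (α.smulRight v) = α v :=
  LinearMap.trace_smulRight (α : E →ₗ[ℝ] ℝ) v

lemma contDiff_det : ContDiff ℝ ∞ (ContinuousLinearMap.det : (E →L[ℝ] E) → ℝ) := by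
  let b := Module.finBasis ℝ E
  have hleibniz : (ContinuousLinearMap.det : (E →L[ℝ] E) → ℝ) = fun A ↦
      ∑ σ : Equiv.Perm (Fin (Module.finrank ℝ E)), ((Equiv.Perm.sign σ : ℤ) : ℝ) *
        ∏ i, LinearMap.toContinuousLinearMap (b.coord (σ i)) (A (b i)) := by
    ext A
    rw [ContinuousLinearMap.det, ← LinearMap.det_toMatrix b, Matrix.det_apply']
    simp [LinearMap.toMatrix_apply]
  rw [hleibniz]
  refine ContDiff.sum fun σ _ ↦ contDiff_const.mul (contDiff_prod fun i _ ↦ ?_)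
  exact (ContinuousLinearMap.contDiff _).comp (contDiff_id.clm_apply contDiff_const)

lemma hasDerivAt_det_id_add_smul (A : E →L[ℝ] E) :
    HasDerivAt (fun t : ℝ ↦ (.id ℝ E + t • A : E →L[ℝ] E).det) (traceL E A) 0 := by
  let b := Module.finBasis ℝ E
  set M := LinearMap.toMatrix b b (A : E →ₗ[ℝ] E)
  have hdet : (fun t : ℝ ↦ (.id ℝ E + t • A : E →L[ℝ] E).det) = fun t ↦ Matrix.det (1 + t • M) := by
    ext t
    rw [ContinuousLinearMap.det, ← LinearMap.det_toMatrix b]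
    simp [M]
  have htrace : traceL E A = Matrix.trace M :=
    LinearMap.trace_eq_matrix_trace ℝ b (A : E →ₗ[ℝ] E)
  rw [hdet, htrace, funext fun t ↦ Matrix.det_one_add_smul t M]
  set P := (Matrix.det (1 + (Polynomial.X : Polynomial ℝ) • M.map Polynomial.C)).divX.divX
  exact (((hasDerivAt_id (0 : ℝ)).const_mul M.trace |>.const_add 1).add
    ((P.hasDerivAt 0).mul (hasDerivAt_pow 2 (0 : ℝ)))).congr_deriv (by simp)

lemma fderiv_det_apply {A : E →L[ℝ] E} (hA : A.IsInvertible) (M : E →L[ℝ] E) :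
    fderiv ℝ ContinuousLinearMap.det A M = A.det * traceL E (A.inverse.comp M) := by
  have hline : HasDerivAt (fun t : ℝ ↦ A + t • M) M 0 := by
    simpa using ((hasDerivAt_id (0 : ℝ)).smul_const M).const_add A
  have hfactor : (ContinuousLinearMap.det ∘ fun t : ℝ ↦ A + t • M) =
      fun t ↦ A.det * (.id ℝ E + t • A.inverse.comp M : E →L[ℝ] E).det := by
    ext t
    have hAt : A + t • M = A.comp (.id ℝ E + t • A.inverse.comp M) := by
      ext x
      simp [hA.self_apply_inverse]
    rw [Function.comp_apply, hAt]
    exact LinearMap.det_comp _ _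
  have hcomp := ((contDiff_det (E := E)).differentiable (by simp)
    (A + (0 : ℝ) • M)).hasFDerivAt.comp_hasDerivAt (0 : ℝ) hline
  rw [hfactor, zero_smul, add_zero] at hcomp
  exact hcomp.unique ((hasDerivAt_det_id_add_smul _).const_mul _)

end TraceDet

section Forms

variable {E : Type*} [NormedAddCommGroup E] [NormedSpace ℝ E]
  {F : Type*} [NormedAddCommGroup F] [NormedSpace ℝ F]

/-- The endomorphism relating two scalar products: `C (relEndo B C x) = B x`. -/
def relEndo (B C : E →L[ℝ] E →L[ℝ] ℝ) : E →L[ℝ] E := C.inverse.comp B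

/-- The weight `|det (C⁻¹ B)| ^ (-1 / (n + 1))` that makes `relEndo B C` a solution of the Sinyukov
equation; note that `Real.log` is the logarithm of the absolute value. -/
def sinyukovScale (B C : E →L[ℝ] E →L[ℝ] ℝ) : ℝ :=
  Real.exp (-(1 / (Module.finrank ℝ E + 1 : ℝ)) * Real.log (relEndo B C).det)

/-- The endomorphism `a` solving the Sinyukov equation of a pair of projectively related metrics. -/
def sinyukovEndo (B C : E →L[ℝ] E →L[ℝ] ℝ) : E →L[ℝ] E := sinyukovScale B C • relEndo B C

lemma sinyukovScale_pos (B C : E →L[ℝ] E →L[ℝ] ℝ) : 0 < sinyukovScale B C := Real.exp_pos _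

variable [FiniteDimensional ℝ E] {B C : E →L[ℝ] E →L[ℝ] ℝ}

lemma apply_relEndo (hC : IsMetricForm C) (x z : E) : C (relEndo B C x) z = B x z :=
  DFunLike.congr_fun (hC.apply_inverse (B x)) z

lemma isInvertible_relEndo (hB : IsMetricForm B) (hC : IsMetricForm C) :
    (relEndo B C).IsInvertible :=
  hC.isInvertible.inverse.comp hB.isInvertible

lemma sinyukovEndo_injective (hB : IsMetricForm B) (hC : IsMetricForm C) :
    Function.Injective (sinyukovEndo B C) :=
  (smul_right_injective E (sinyukovScale_pos B C).ne').comp (isInvertible_relEndo hB hC).injective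

lemma sinyukovEndo_selfAdjoint (hB : IsMetricForm B) (hC : IsMetricForm C) (x z : E) :
    B (sinyukovEndo B C x) z = B x (sinyukovEndo B C z) := by
  have hrel : B (relEndo B C x) z = B x (relEndo B C z) := by
    rw [hB.symm, ← apply_relEndo hC z, ← apply_relEndo hC x, hC.symm]
  simp [sinyukovEndo, hrel]

lemma sinyukovScale_symm (hB : IsMetricForm B) (hC : IsMetricForm C) :
    sinyukovScale C B = (sinyukovScale B C)⁻¹ := by
  have hcomp : (relEndo C B).comp (relEndo B C) = .id ℝ E :=
    ContinuousLinearMap.ext fun x ↦ hB.ext fun z ↦ by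
      rw [ContinuousLinearMap.comp_apply, apply_relEndo hB, apply_relEndo hC]
      rfl
  have hdet : (relEndo C B).det = (relEndo B C).det⁻¹ :=
    eq_inv_of_mul_eq_one_left <| (LinearMap.det_comp _ _).symm.trans <|
      (congrArg ContinuousLinearMap.det hcomp).trans LinearMap.det_id
  rw [sinyukovScale, sinyukovScale, hdet, Real.log_inv, mul_neg, Real.exp_neg]

variable [FiniteDimensional ℝ F] {L : F →L[ℝ] E}

lemma map_relEndo_bilinearComp (hC : IsMetricForm C) (hL : L.IsInvertible) (x : F) :
    L (relEndo (B.bilinearComp L L) (C.bilinearComp L L) x) = relEndo B C (L x) := by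
  refine hC.ext fun w ↦ ?_
  obtain ⟨w, rfl⟩ := hL.surjective w
  rw [apply_relEndo hC]
  exact apply_relEndo (hC.bilinearComp hL) x w

lemma sinyukovScale_bilinearComp (hC : IsMetricForm C) (hL : L.IsInvertible) :
    sinyukovScale (B.bilinearComp L L) (C.bilinearComp L L) = sinyukovScale B C := by
  obtain ⟨e, he⟩ := hL
  have hconj : relEndo (B.bilinearComp L L) (C.bilinearComp L L) =
      (e.symm : E →L[ℝ] F).comp ((relEndo B C).comp (e : F →L[ℝ] E)) := by
    ext x
    rw [ContinuousLinearMap.comp_apply, ContinuousLinearMap.comp_apply,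
      ContinuousLinearEquiv.coe_coe, ContinuousLinearEquiv.coe_coe,
      ContinuousLinearEquiv.eq_symm_apply, ← ContinuousLinearEquiv.coe_coe, he]
    exact map_relEndo_bilinearComp hC ⟨e, he⟩ x
  have hdet : (relEndo (B.bilinearComp L L) (C.bilinearComp L L)).det = (relEndo B C).det := by
    rw [hconj]
    exact LinearMap.det_conj (relEndo B C : E →ₗ[ℝ] E) e.symm.toLinearEquiv
  rw [sinyukovScale, sinyukovScale, hdet, e.toLinearEquiv.finrank_eq]

lemma map_sinyukovEndo_bilinearComp (hC : IsMetricForm C) (hL : L.IsInvertible) (x : F) :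
    L (sinyukovEndo (B.bilinearComp L L) (C.bilinearComp L L) x) = sinyukovEndo B C (L x) := by
  rw [sinyukovEndo, smul_apply, map_smul, map_relEndo_bilinearComp hC hL,
    sinyukovScale_bilinearComp hC hL]
  rfl

end Forms

section CovEndo

variable {E : Type*} [NormedAddCommGroup E] [NormedSpace ℝ E]
  {G : E → E →L[ℝ] E →L[ℝ] ℝ} {a : E → E →L[ℝ] E} {y : E}

/-- The covariant derivative `∇_v a` at `y` of the endomorphism field `a`. -/
def covEndo (G : E → E →L[ℝ] E →L[ℝ] ℝ) (a : E → E →L[ℝ] E) (y v : E) : E →L[ℝ] E :=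
  fderiv ℝ a y v + (leviCivita G y v).comp (a y) - (a y).comp (leviCivita G y v)

lemma covEndo_apply (v x : E) : covEndo G a y v x =
    fderiv ℝ a y v x + leviCivita G y v (a y x) - a y (leviCivita G y v x) := rfl

lemma covEndo_congr {a' : E → E →L[ℝ] E} (h : a =ᶠ[𝓝 y] a') : covEndo G a y = covEndo G a' y := by
  ext1 v
  rw [covEndo, covEndo, h.fderiv_eq, h.self_of_nhds]

lemma cov_clm_apply {V : E → E} (ha : DifferentiableAt ℝ a y) (hV : DifferentiableAt ℝ V y)
    (v : E) : cov G (fun z ↦ a z (V z)) y v = covEndo G a y v (V y) + a y (cov G V y v) := by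
  rw [cov_apply, (ha.hasFDerivAt.clm_apply hV.hasFDerivAt).fderiv, covEndo_apply, cov_apply]
  simp only [add_apply, ContinuousLinearMap.comp_apply, ContinuousLinearMap.flip_apply, map_add]
  abel

variable [FiniteDimensional ℝ E]

lemma traceL_covEndo (v : E) : traceL E (covEndo G a y v) = traceL E (fderiv ℝ a y v) := by
  rw [covEndo, map_sub, map_add, traceL_comp_comm, add_sub_cancel_right]

lemma traceL_inverse_comp_covEndo (ha : (a y).IsInvertible) (v : E) :
    traceL E ((a y).inverse.comp (covEndo G a y v)) =
      traceL E ((a y).inverse.comp (fderiv ℝ a y v)) := by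
  have hcancel : (a y).inverse.comp ((a y).comp (leviCivita G y v)) = leviCivita G y v := by
    rw [← ContinuousLinearMap.comp_assoc, ha.inverse_comp_self, ContinuousLinearMap.id_comp]
  rw [covEndo, ContinuousLinearMap.comp_sub, ContinuousLinearMap.comp_add, hcancel, map_sub,
    map_add, traceL_comp_comm _ ((leviCivita G y v).comp (a y)), ContinuousLinearMap.comp_assoc,
    ha.self_comp_inverse, ContinuousLinearMap.comp_id, add_sub_cancel_right]

end CovEndo

section Pair

variable {E : Type*} [NormedAddCommGroup E] [NormedSpace ℝ E] [FiniteDimensional ℝ E]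
  {G H : E → E →L[ℝ] E →L[ℝ] ℝ} {Ω : Set E} {y : E} {ψ : E →L[ℝ] ℝ}

/-- The Levi-Civita connections of `G` and `H` at `y` differ by `ψ ⊗ id + id ⊗ ψ`. -/
def IsProjectiveDifferenceAt (G H : E → E →L[ℝ] E →L[ℝ] ℝ) (y : E) (ψ : E →L[ℝ] ℝ) : Prop :=
  ∀ u v, leviCivita H y u v = leviCivita G y u v + ψ u • v + ψ v • u

omit [FiniteDimensional ℝ E] in
lemma IsProjectiveDifferenceAt.symm (hψ : IsProjectiveDifferenceAt G H y ψ) :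
    IsProjectiveDifferenceAt H G y (-ψ) := by
  intro u v
  rw [hψ u v, neg_apply, neg_apply]
  module

/-- Half the trace of the Sinyukov endomorphism. -/
def sinyukovPotential (B C : E →L[ℝ] E →L[ℝ] ℝ) : ℝ := (1 / 2 : ℝ) * traceL E (sinyukovEndo B C)

/-- The vector field `λ = grad (½ tr a)`, where `a` is the Sinyukov endomorphism of `G` and `H`. -/
def sinyukovGrad (G H : E → E →L[ℝ] E →L[ℝ] ℝ) (y : E) : E :=
  (G y).inverse (fderiv ℝ (fun z ↦ sinyukovPotential (G z) (H z)) y)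

lemma IsMetricOn.apply_sinyukovGrad (hG : IsMetricOn G Ω) (hy : y ∈ Ω) :
    G y (sinyukovGrad G H y) = fderiv ℝ (fun z ↦ sinyukovPotential (G z) (H z)) y :=
  (hG.isMetricForm y hy).apply_inverse _

section Smooth

variable (hG : IsMetricOn G Ω) (hH : IsMetricOn H Ω) (hy : y ∈ Ω)
include hG hH hy

lemma contDiffAt_relEndo : ContDiffAt ℝ ∞ (fun z ↦ relEndo (G z) (H z)) y :=
  (((hH.isMetricForm y hy).isInvertible.contDiffAt_map_inverse (n := ∞)).comp y
    (hH.contDiffAt hy)).clm_comp (hG.contDiffAt hy)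

lemma contDiffAt_sinyukovScale : ContDiffAt ℝ ∞ (fun z ↦ sinyukovScale (G z) (H z)) y := by
  refine ContDiffAt.exp (contDiffAt_const.mul (ContDiffAt.log ?_ ?_))
  · exact contDiff_det.contDiffAt.comp y (contDiffAt_relEndo hG hH hy)
  · exact det_ne_zero_of_isInvertible
      (isInvertible_relEndo (hG.isMetricForm y hy) (hH.isMetricForm y hy))

lemma contDiffAt_sqrt_sinyukovScale : ContDiffAt ℝ ∞ (fun z ↦ √(sinyukovScale (G z) (H z))) y :=
  (contDiffAt_sinyukovScale hG hH hy).sqrt (sinyukovScale_pos _ _).ne'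

lemma contDiffAt_sinyukovEndo : ContDiffAt ℝ ∞ (fun z ↦ sinyukovEndo (G z) (H z)) y :=
  (contDiffAt_sinyukovScale hG hH hy).smul (contDiffAt_relEndo hG hH hy)

lemma contDiffAt_sinyukovPotential :
    ContDiffAt ℝ ∞ (fun z ↦ sinyukovPotential (G z) (H z)) y :=
  contDiffAt_const.mul ((traceL E).contDiff.contDiffAt.comp y (contDiffAt_sinyukovEndo hG hH hy))

lemma contDiffAt_sinyukovGrad : ContDiffAt ℝ ∞ (sinyukovGrad G H) y :=
  (((hG.isMetricForm y hy).isInvertible.contDiffAt_map_inverse (n := ∞)).comp y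
    (hG.contDiffAt hy)).clm_apply
      ((contDiffAt_sinyukovPotential hG hH hy).fderiv_right (m := ∞) (by simp))

end Smooth

variable (hG : IsMetricOn G Ω) (hH : IsMetricOn H Ω) (hy : y ∈ Ω)
  (hψ : IsProjectiveDifferenceAt G H y ψ)
include hG hH hy hψ

lemma covEndo_relEndo (v x : E) :
    covEndo G (fun z ↦ relEndo (G z) (H z)) y v x =
      (-2 * ψ v) • relEndo (G y) (H y) x - ψ (relEndo (G y) (H y) x) • v
        - G y x v • (H y).inverse ψ := by
  set A := fun z ↦ relEndo (G z) (H z)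
  have hA : DifferentiableAt ℝ A y := (contDiffAt_relEndo hG hH hy).differentiableAt (by simp)
  have hHy := hH.isMetricForm y hy
  have hrel : ∀ w z, H y (A y w) z = G y w z := fun w z ↦ apply_relEndo hHy w z
  have hinverse : ∀ z, H y ((H y).inverse ψ) z = ψ z := DFunLike.congr_fun (hHy.apply_inverse ψ)
  change _ = (-2 * ψ v) • A y x - ψ (A y x) • v - G y x v • (H y).inverse ψ
  refine hHy.ext fun z ↦ ?_
  have hHA : (fun w ↦ H w (A w x) z) =ᶠ[𝓝 y] fun w ↦ G w x z := by
    filter_upwards [hG.isOpen.mem_nhds hy] with w hw using apply_relEndo (hH.isMetricForm w hw) x z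
  have hleft := ((hH.differentiableAt hy).hasFDerivAt.clm_apply
    (hA.hasFDerivAt.clm_apply (hasFDerivAt_const x y))).clm_apply (hasFDerivAt_const z y)
  have hderiv := DFunLike.congr_fun (hleft.fderiv.symm.trans hHA.fderiv_eq) v
  rw [← hG.fderiv_apply₂ hy] at hderiv
  simp only [add_apply, ContinuousLinearMap.comp_apply, ContinuousLinearMap.flip_apply, zero_apply,
    map_zero, zero_add, hH.fderiv_eq_leviCivita hy, hG.fderiv_eq_leviCivita hy, hψ v, map_add,
    map_smul, smul_apply, smul_eq_mul, hrel] at hderiv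
  simp only [covEndo_apply, map_add, map_sub, map_smul, add_apply, sub_apply, smul_apply, hrel,
    hinverse, smul_eq_mul]
  linear_combination hderiv

lemma traceL_inverse_comp_fderiv_relEndo (v : E) :
    traceL E ((relEndo (G y) (H y)).inverse.comp (fderiv ℝ (fun z ↦ relEndo (G z) (H z)) y v)) =
      -2 * (Module.finrank ℝ E + 1) * ψ v := by
  set A := fun z ↦ relEndo (G z) (H z)
  have hHy := hH.isMetricForm y hy
  have hA : (A y).IsInvertible := isInvertible_relEndo (hG.isMetricForm y hy) hHy
  have hcov : (A y).inverse.comp (covEndo G A y v) = (-2 * ψ v) • ContinuousLinearMap.id ℝ E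
      - (ψ.comp (A y)).smulRight ((A y).inverse v)
      - ((G y).flip v).smulRight ((A y).inverse ((H y).inverse ψ)) := by
    ext x
    simp [covEndo_relEndo hG hH hy hψ, hA.inverse_apply_self, A]
  have hG_inverse : G y ((A y).inverse ((H y).inverse ψ)) v = ψ v := by
    rw [← apply_relEndo (B := G y) hHy, hA.self_apply_inverse, hHy.apply_inverse]
  rw [← traceL_inverse_comp_covEndo (G := G) hA, hcov, map_sub, map_sub, map_smul, traceL_id,
    traceL_smulRight, traceL_smulRight, ContinuousLinearMap.comp_apply, hA.self_apply_inverse,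
    ContinuousLinearMap.flip_apply, hG_inverse, smul_eq_mul]
  ring

lemma fderiv_sinyukovScale (v : E) :
    fderiv ℝ (fun z ↦ sinyukovScale (G z) (H z)) y v = 2 * ψ v * sinyukovScale (G y) (H y) := by
  set A := fun z ↦ relEndo (G z) (H z)
  have hA : DifferentiableAt ℝ A y := (contDiffAt_relEndo hG hH hy).differentiableAt (by simp)
  have hinv : (A y).IsInvertible :=
    isInvertible_relEndo (hG.isMetricForm y hy) (hH.isMetricForm y hy)
  have hdet_ne : (relEndo (G y) (H y)).det ≠ 0 := det_ne_zero_of_isInvertible hinv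
  have hdet : HasFDerivAt (fun z ↦ (A z).det)
      ((fderiv ℝ ContinuousLinearMap.det (A y)).comp (fderiv ℝ A y)) y :=
    ((contDiff_det.differentiable (by simp)) (A y)).hasFDerivAt.comp y hA.hasFDerivAt
  have hscale : fderiv ℝ (fun z ↦ sinyukovScale (G z) (H z)) y = _ :=
    ((hdet.log hdet_ne).const_mul (-(1 / (Module.finrank ℝ E + 1 : ℝ)))).exp.fderiv
  have hdim : (Module.finrank ℝ E + 1 : ℝ) ≠ 0 := by positivity
  rw [hscale]
  simp only [smul_apply, ContinuousLinearMap.comp_apply, fderiv_det_apply hinv,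
    traceL_inverse_comp_fderiv_relEndo hG hH hy hψ, smul_eq_mul, A]
  change sinyukovScale (G y) (H y) * _ = _
  field_simp

lemma fderiv_inv_sqrt_sinyukovScale (v : E) :
    fderiv ℝ (fun z ↦ (√(sinyukovScale (G z) (H z)))⁻¹) y v =
      -(ψ v * (√(sinyukovScale (G y) (H y)))⁻¹) := by
  have hs := sinyukovScale_pos (G y) (H y)
  have hsqrt_ne : √(sinyukovScale (G y) (H y)) ≠ 0 := (Real.sqrt_pos.2 hs).ne'
  have hscale := ((contDiffAt_sinyukovScale hG hH hy).differentiableAt (by simp)).hasFDerivAt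
  have hinv : fderiv ℝ (fun z ↦ (√(sinyukovScale (G z) (H z)))⁻¹) y = _ :=
    ((hasDerivAt_inv hsqrt_ne).comp_hasFDerivAt y (hscale.sqrt hs.ne')).fderiv
  rw [hinv]
  simp only [smul_apply, smul_eq_mul, fderiv_sinyukovScale hG hH hy hψ, Real.sq_sqrt hs.le]
  field_simp

lemma cov_inv_sqrt_sinyukovScale_smul {V : E → E} (hV : DifferentiableAt ℝ V y) :
    cov H (fun z ↦ (√(sinyukovScale (G z) (H z)))⁻¹ • V z) y =
      (√(sinyukovScale (G y) (H y)))⁻¹ • (cov G V y + ψ (V y) • .id ℝ E) := by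
  have hsqrt_ne : √(sinyukovScale (G y) (H y)) ≠ 0 := (Real.sqrt_pos.2 (sinyukovScale_pos _ _)).ne'
  have hinv : DifferentiableAt ℝ (fun z ↦ (√(sinyukovScale (G z) (H z)))⁻¹) y :=
    ((contDiffAt_sqrt_sinyukovScale hG hH hy).inv hsqrt_ne).differentiableAt (by simp)
  ext1 v
  rw [cov_smul hinv hV, fderiv_inv_sqrt_sinyukovScale hG hH hy hψ, cov_apply, hψ]
  simp only [smul_apply, add_apply, cov_apply, ContinuousLinearMap.id_apply]
  module

/-- The derivative of the weight `sinyukovScale` exactly cancels the term of `covEndo_relEndo`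
proportional to `relEndo`. -/
lemma covEndo_sinyukovEndo_of_inverse (v x : E) :
    covEndo G (fun z ↦ sinyukovEndo (G z) (H z)) y v x =
      -(ψ (sinyukovEndo (G y) (H y) x) • v
        + G y x v • sinyukovScale (G y) (H y) • (H y).inverse ψ) := by
  have hs := ((contDiffAt_sinyukovScale hG hH hy).differentiableAt (by simp)).hasFDerivAt
  have hA := ((contDiffAt_relEndo hG hH hy).differentiableAt (by simp)).hasFDerivAt
  have hsA : HasFDerivAt (fun z ↦ sinyukovEndo (G z) (H z)) _ y := hs.smul hA
  have hrel := covEndo_relEndo hG hH hy hψ v x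
  rw [covEndo_apply] at hrel
  rw [covEndo_apply, hsA.fderiv]
  simp only [sinyukovEndo, add_apply, smul_apply, ContinuousLinearMap.smulRight_apply, map_smul,
    fderiv_sinyukovScale hG hH hy hψ]
  linear_combination (norm := module) sinyukovScale (G y) (H y) • hrel

lemma sinyukovGrad_eq : sinyukovGrad G H y = -(sinyukovScale (G y) (H y) • (H y).inverse ψ) := by
  have hGy := hG.isMetricForm y hy
  have hHy := hH.isMetricForm y hy
  set a := fun z ↦ sinyukovEndo (G z) (H z)
  set l := sinyukovScale (G y) (H y) • (H y).inverse ψ with hl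
  refine hGy.ext fun v ↦ ?_
  have hcov : covEndo G a y v = -((ψ.comp (a y)).smulRight v + ((G y).flip v).smulRight l) :=
    ContinuousLinearMap.ext (covEndo_sinyukovEndo_of_inverse hG hH hy hψ v)
  have hψa : ψ (a y v) = G y l v := by
    rw [← DFunLike.congr_fun (hHy.apply_inverse ψ), hHy.symm, hl]
    simp only [a, sinyukovEndo, smul_apply, map_smul, apply_relEndo hHy]
    rw [hGy.symm]
  have ha := ((contDiffAt_sinyukovEndo hG hH hy).differentiableAt (by simp)).hasFDerivAt
  have htrace : fderiv ℝ (fun z ↦ sinyukovPotential (G z) (H z)) y = _ :=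
    (((traceL E).hasFDerivAt.comp y ha).const_mul (1 / 2 : ℝ)).fderiv
  rw [hG.apply_sinyukovGrad hy, htrace, smul_apply, ContinuousLinearMap.comp_apply,
    ← traceL_covEndo (G := G), hcov, map_neg, map_add, traceL_smulRight, traceL_smulRight,
    ContinuousLinearMap.comp_apply, hψa, ContinuousLinearMap.flip_apply, map_neg, neg_apply,
    smul_eq_mul]
  ring

lemma apply_sinyukovEndo_eq_neg (x : E) :
    ψ (sinyukovEndo (G y) (H y) x) = -G y (sinyukovGrad G H y) x := by
  have hHy := hH.isMetricForm y hy
  rw [sinyukovGrad_eq hG hH hy hψ, (hG.isMetricForm y hy).symm,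
    ← DFunLike.congr_fun (hHy.apply_inverse ψ), hHy.symm]
  simp [sinyukovEndo, apply_relEndo hHy]

lemma covEndo_sinyukovEndo (v x : E) :
    covEndo G (fun z ↦ sinyukovEndo (G z) (H z)) y v x =
      G y (sinyukovGrad G H y) x • v + G y x v • sinyukovGrad G H y := by
  rw [covEndo_sinyukovEndo_of_inverse hG hH hy hψ, apply_sinyukovEndo_eq_neg hG hH hy hψ,
    sinyukovGrad_eq hG hH hy hψ]
  module

end Pair

section SinyukovSolution

variable {E : Type*} [NormedAddCommGroup E] [NormedSpace ℝ E]
  {G : E → E →L[ℝ] E →L[ℝ] ℝ} {Ω : Set E} {y : E} {a : E → E →L[ℝ] E} {l : E → E}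

/-- A solution of the Sinyukov equation `∇_v a x = G(l, x) v + G(x, v) l` of the metric `G`: a field
`a` of self-adjoint endomorphisms together with a vector field `l`. -/
structure IsSinyukovSolution (G : E → E →L[ℝ] E →L[ℝ] ℝ) (a : E → E →L[ℝ] E) (l : E → E)
    (Ω : Set E) : Prop where
  contDiffAt_endo (y : E) (hy : y ∈ Ω) : ContDiffAt ℝ ∞ a y
  contDiffAt_grad (y : E) (hy : y ∈ Ω) : ContDiffAt ℝ ∞ l y
  selfAdjoint (y : E) (hy : y ∈ Ω) (x z : E) : G y (a y x) z = G y x (a y z)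
  covEndo_apply (y : E) (hy : y ∈ Ω) (v x : E) : covEndo G a y v x = G y (l y) x • v + G y x v • l y

namespace IsSinyukovSolution

lemma differentiableAt_endo (ha : IsSinyukovSolution G a l Ω) (hy : y ∈ Ω) :
    DifferentiableAt ℝ a y :=
  (ha.contDiffAt_endo y hy).differentiableAt (by simp)

lemma differentiableAt_grad (ha : IsSinyukovSolution G a l Ω) (hy : y ∈ Ω) :
    DifferentiableAt ℝ l y :=
  (ha.contDiffAt_grad y hy).differentiableAt (by simp)

lemma cov_endo_apply (ha : IsSinyukovSolution G a l Ω) (hy : y ∈ Ω) {V : E → E}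
    (hV : DifferentiableAt ℝ V y) (v : E) : cov G (fun z ↦ a z (V z)) y v =
      G y (l y) (V y) • v + G y (V y) v • l y + a y (cov G V y v) := by
  rw [cov_clm_apply (ha.differentiableAt_endo hy) hV, ha.covEndo_apply y hy]

lemma apply_grad [FiniteDimensional ℝ E] (ha : IsSinyukovSolution G a l Ω) (hG : IsMetricOn G Ω)
    (hy : y ∈ Ω) : G y (l y) = fderiv ℝ (fun z ↦ (1 / 2 : ℝ) * traceL E (a z)) y := by
  ext v
  have htrace : fderiv ℝ (fun z ↦ (1 / 2 : ℝ) * traceL E (a z)) y = _ :=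
    (((traceL E).hasFDerivAt.comp y (ha.differentiableAt_endo hy).hasFDerivAt).const_mul
      (1 / 2 : ℝ)).fderiv
  have hcov : covEndo G a y v = (G y (l y)).smulRight v + ((G y).flip v).smulRight (l y) :=
    ContinuousLinearMap.ext (ha.covEndo_apply y hy v)
  rw [htrace, smul_apply, ContinuousLinearMap.comp_apply, ← traceL_covEndo (G := G), hcov, map_add,
    traceL_smulRight, traceL_smulRight, ContinuousLinearMap.flip_apply,
    (hG.isMetricForm y hy).symm (l y), smul_eq_mul]
  ring

lemma congr (ha : IsSinyukovSolution G a l Ω) (hΩ : IsOpen Ω) {a' : E → E →L[ℝ] E} {l' : E → E}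
    (haa' : Set.EqOn a a' Ω) (hll' : Set.EqOn l l' Ω) : IsSinyukovSolution G a' l' Ω where
  contDiffAt_endo y hy := (ha.contDiffAt_endo y hy).congr_of_eventuallyEq
    (haa'.symm.eventuallyEq_of_mem (hΩ.mem_nhds hy))
  contDiffAt_grad y hy := (ha.contDiffAt_grad y hy).congr_of_eventuallyEq
    (hll'.symm.eventuallyEq_of_mem (hΩ.mem_nhds hy))
  selfAdjoint y hy := haa' hy ▸ ha.selfAdjoint y hy
  covEndo_apply y hy := by
    rw [covEndo_congr (haa'.symm.eventuallyEq_of_mem (hΩ.mem_nhds hy)), ← hll' hy]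
    exact ha.covEndo_apply y hy

end IsSinyukovSolution

lemma isSinyukovSolution_sinyukovEndo [FiniteDimensional ℝ E] {H : E → E →L[ℝ] E →L[ℝ] ℝ}
    (hG : IsMetricOn G Ω) (hH : IsMetricOn H Ω)
    (hGH : ∀ y ∈ Ω, ∃ ψ, IsProjectiveDifferenceAt G H y ψ) :
    IsSinyukovSolution G (fun z ↦ sinyukovEndo (G z) (H z)) (sinyukovGrad G H) Ω where
  contDiffAt_endo y hy := contDiffAt_sinyukovEndo hG hH hy
  contDiffAt_grad y hy := contDiffAt_sinyukovGrad hG hH hy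
  selfAdjoint y hy := sinyukovEndo_selfAdjoint (hG.isMetricForm y hy) (hH.isMetricForm y hy)
  covEndo_apply y hy := by
    obtain ⟨ψ, hψ⟩ := hGH y hy
    exact covEndo_sinyukovEndo hG hH hy hψ

end SinyukovSolution

/-! ### Curvature -/

section Curvature

variable {E : Type*} [NormedAddCommGroup E] [NormedSpace ℝ E]
  {G : E → E →L[ℝ] E →L[ℝ] ℝ} {Ω : Set E} {y : E}

/-- The curvature tensor `R(u, v) w` of the Levi-Civita connection. -/
def curvature (G : E → E →L[ℝ] E →L[ℝ] ℝ) (y u v w : E) : E :=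
  fderiv ℝ (leviCivita G) y u v w - fderiv ℝ (leviCivita G) y v u w
    + leviCivita G y u (leviCivita G y v w) - leviCivita G y v (leviCivita G y u w)

lemma curvature_swap (u v w : E) : curvature G y u v w = -curvature G y v u w := by
  rw [curvature, curvature]
  abel

namespace IsMetricForm

variable {B : E →L[ℝ] E →L[ℝ] ℝ} {L : E →L[ℝ] E} {p : E}

lemma exists_apply_eq_one (hB : IsMetricForm B) (hp : p ≠ 0) : ∃ w, B p w = 1 := by
  obtain ⟨w, hw⟩ : ∃ w, B p w ≠ 0 := by
    by_contra! hzero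
    exact hp (hB.nondegenerate p hzero)
  exact ⟨(B p w)⁻¹ • w, by rw [map_smul, smul_eq_mul, inv_mul_cancel₀ hw]⟩

lemma exists_eq_smul_of_apply_add_apply (hB : IsMetricForm B) (hp : p ≠ 0)
    (hL : ∀ v z, B (L v) z = B (L z) v)
    (h : ∀ v x z, B (L p) x * B v z + B x v * B (L p) z =
      B (L v) x * B p z + B x p * B (L v) z) :
    ∃ μ : ℝ, ∀ v, L v = μ • v := by
  set P : E → E → E → ℝ := fun w v z ↦ B p w * B (L v) z - B (L p) w * B v z with hP
  have hanti : ∀ w v z, P w v z = -P z v w := fun w v z ↦ by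
    have hvwz := h v w z
    rw [hB.symm w v, hB.symm w p] at hvwz
    linear_combination -hvwz
  have hsymm : ∀ w v z, P w v z = P w z v := fun w v z ↦ by
    simp only [hP, hL v z, hB.symm v z]
  have hzero : ∀ w v z, P w v z = 0 := fun w v z ↦ by
    linarith [hanti w v z, hsymm z v w, hanti z w v, hsymm v w z, hanti v z w, hsymm w z v]
  obtain ⟨w, hw⟩ := hB.exists_apply_eq_one hp
  refine ⟨B (L p) w, fun v ↦ hB.ext fun z ↦ ?_⟩
  have hwvz := hzero w v z
  rw [hP] at hwvz
  rw [map_smul, smul_apply, smul_eq_mul]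
  linear_combination hwvz - B (L v) z * hw

end IsMetricForm

variable [FiniteDimensional ℝ E]

namespace IsMetricOn

variable (hG : IsMetricOn G Ω) (hy : y ∈ Ω)
include hG hy

lemma contDiffAt_cov {V : E → E} (hV : ContDiffAt ℝ ∞ V y) : ContDiffAt ℝ ∞ (cov G V) y :=
  (hV.fderiv_right (m := ∞) (by simp)).add
    (((ContinuousLinearMap.flipₗᵢ ℝ E E E).contDiff.contDiffAt.comp y
      (hG.contDiffAt_leviCivita hy)).clm_apply hV)

lemma differentiableAt_cov_apply {V : E → E} (hV : ContDiffAt ℝ ∞ V y) (v : E) :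
    DifferentiableAt ℝ (fun z ↦ cov G V z v) y :=
  ((hG.contDiffAt_cov hy hV).clm_apply contDiffAt_const).differentiableAt (by simp)

lemma cov_cov_sub_cov_cov {V : E → E} (hV : ContDiffAt ℝ ∞ V y) (u v : E) :
    cov G (fun z ↦ cov G V z v) y u - cov G (fun z ↦ cov G V z u) y v =
      curvature G y u v (V y) := by
  have hexpand : ∀ u v, cov G (fun z ↦ cov G V z v) y u = fderiv ℝ (fderiv ℝ V) y u v
      + fderiv ℝ (leviCivita G) y u v (V y) + leviCivita G y v (fderiv ℝ V y u)
      + leviCivita G y u (fderiv ℝ V y v) + leviCivita G y u (leviCivita G y v (V y)) := by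
    intro u v
    have hV'' := ((hV.fderiv_right (m := ∞) (by simp)).differentiableAt (by simp)).hasFDerivAt
    have hΓ := ((hG.contDiffAt_leviCivita hy).differentiableAt (by simp)).hasFDerivAt
    have hVy := (hV.differentiableAt (by simp)).hasFDerivAt
    have hder : HasFDerivAt (fun z ↦ cov G V z v) _ y :=
      (hV''.clm_apply (hasFDerivAt_const v y)).add
        ((hΓ.clm_apply (hasFDerivAt_const v y)).clm_apply hVy)
    rw [cov_apply, hder.fderiv, cov_apply]
    simp only [add_apply, ContinuousLinearMap.comp_apply, ContinuousLinearMap.flip_apply,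
      zero_apply, map_zero, zero_add, map_add]
    abel
  rw [hexpand, hexpand, (isSymmSndFDerivAt_of_smooth hV).eq v u, curvature]
  abel

lemma cov_const_symm (v w : E) :
    cov G (fun z ↦ cov G (fun _ ↦ w) z v) y = cov G (fun z ↦ cov G (fun _ ↦ v) z w) y := by
  refine cov_congr ?_
  filter_upwards [hG.isOpen.mem_nhds hy] with z hz
  simp [cov_apply, hG.leviCivita_symm hz v w]

lemma curvature_bianchi (u v w : E) :
    curvature G y u v w + curvature G y v w u + curvature G y w u v = 0 := by
  have hricci : ∀ u v w : E, _ = curvature G y u v w := fun u v w ↦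
    hG.cov_cov_sub_cov_cov hy (contDiffAt_const (c := w)) u v
  rw [← hricci, ← hricci, ← hricci, hG.cov_const_symm hy v w, hG.cov_const_symm hy u w,
    hG.cov_const_symm hy u v]
  abel

lemma curvature_skew (u v w z : E) :
    G y (curvature G y u v w) z = -G y (curvature G y u v z) w := by
  have hconst : ∀ x : E, ContDiffAt ℝ ∞ (fun _ : E ↦ x) y := fun x ↦ contDiffAt_const
  have hmetric : ContDiffAt ℝ ∞ (fun x ↦ G x w z) y :=
    ((hG.contDiffAt hy).clm_apply contDiffAt_const).clm_apply contDiffAt_const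
  have hsnd : ∀ u v, fderiv ℝ (fderiv ℝ fun x ↦ G x w z) y u v =
      G y (cov G (fun x ↦ cov G (fun _ ↦ w) x v) y u) z
      + G y (cov G (fun _ ↦ w) y v) (cov G (fun _ ↦ z) y u)
      + (G y (cov G (fun _ ↦ w) y u) (cov G (fun _ ↦ z) y v)
      + G y w (cov G (fun x ↦ cov G (fun _ ↦ z) x v) y u)) := by
    intro u v
    have hw := hG.differentiableAt_cov_apply hy (hconst w) v
    have hz := hG.differentiableAt_cov_apply hy (hconst z) v
    have hfst : (fun x ↦ fderiv ℝ (fun x ↦ G x w z) x v) =ᶠ[𝓝 y] fun x ↦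
        G x (cov G (fun _ ↦ w) x v) z + G x w (cov G (fun _ ↦ z) x v) := by
      filter_upwards [hG.isOpen.mem_nhds hy] with x hx using
        hG.fderiv_apply_apply hx (differentiableAt_const w) (differentiableAt_const z) v
    have happly := ((hmetric.fderiv_right (m := ∞) (by simp)).differentiableAt
      (by simp)).hasFDerivAt.clm_apply (hasFDerivAt_const v y)
    have hGy := hG.differentiableAt hy
    rw [← hG.fderiv_apply_apply hy hw (differentiableAt_const z),
      ← hG.fderiv_apply_apply hy (differentiableAt_const w) hz, ← add_apply, ← fderiv_fun_add
      ((hGy.clm_apply hw).clm_apply (differentiableAt_const z))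
      ((hGy.clm_apply (differentiableAt_const w)).clm_apply hz), ← hfst.fderiv_eq, happly.fderiv]
    simp
  have hsymm := (isSymmSndFDerivAt_of_smooth hmetric).eq u v
  rw [hsnd, hsnd] at hsymm
  rw [(hG.isMetricForm y hy).symm (curvature G y u v z), ← hG.cov_cov_sub_cov_cov hy (hconst w),
    ← hG.cov_cov_sub_cov_cov hy (hconst z), map_sub, map_sub, sub_apply]
  linear_combination hsymm

lemma curvature_pair_symm (u v w z : E) :
    G y (curvature G y u v w) z = G y (curvature G y w z u) v := by
  have hbianchi : ∀ u v w z, G y (curvature G y u v w) z + G y (curvature G y v w u) z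
      + G y (curvature G y w u v) z = 0 := fun u v w z ↦ by
    simpa using congrArg (fun x ↦ G y x z) (hG.curvature_bianchi hy u v w)
  have hskew := hG.curvature_skew hy
  have hswap : ∀ u v w z, G y (curvature G y u v w) z = -G y (curvature G y v u w) z :=
    fun u v w z ↦ by rw [curvature_swap, map_neg, neg_apply]
  linarith [hbianchi u v w z, hbianchi v w z u, hbianchi w z u v, hbianchi z u v w, hskew v w z u,
    hskew w z v u, hskew z u w v, hskew u v z w, hskew u w z v, hswap u w v z, hskew v z u w,
    hswap v z w u]

lemma curvature_apply_parallel {φ : E → E} (hφ : ContDiffAt ℝ ∞ φ y)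
    (hcov : ∀ z ∈ Ω, cov G φ z = 0) (u v : E) : curvature G y u v (φ y) = 0 := by
  have hzero : ∀ u v, cov G (fun z ↦ cov G φ z v) y u = 0 := fun u v ↦ by
    have hev : (fun z ↦ cov G φ z v) =ᶠ[𝓝 y] fun _ ↦ 0 := by
      filter_upwards [hG.isOpen.mem_nhds hy] with z hz
      rw [hcov z hz, zero_apply]
    rw [cov_congr hev, cov_zero, zero_apply]
  rw [← hG.cov_cov_sub_cov_cov hy hφ, hzero, hzero, sub_zero]

lemma curvature_parallel_left {φ : E → E} (hφ : ContDiffAt ℝ ∞ φ y)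
    (hcov : ∀ z ∈ Ω, cov G φ z = 0) (v w : E) : curvature G y (φ y) v w = 0 :=
  (hG.isMetricForm y hy).ext fun z ↦ by
    rw [hG.curvature_pair_symm hy, hG.curvature_apply_parallel hy hφ hcov, map_zero, zero_apply,
      zero_apply]

lemma cov_symm_of_eq_fderiv {T : E → ℝ} {l : E → E} (hT : ContDiffAt ℝ ∞ T y)
    (hl : DifferentiableAt ℝ l y) (hTl : ∀ z ∈ Ω, G z (l z) = fderiv ℝ T z) (u v : E) :
    G y (cov G l y u) v = G y (cov G l y v) u := by
  have hhessian : ∀ u v, fderiv ℝ (fderiv ℝ T) y u v =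
      G y (cov G l y u) v + G y (l y) (leviCivita G y u v) := by
    intro u v
    have hfst : (fun z ↦ fderiv ℝ T z v) =ᶠ[𝓝 y] fun z ↦ G z (l z) v := by
      filter_upwards [hG.isOpen.mem_nhds hy] with z hz
      rw [hTl z hz]
    have happly := ((hT.fderiv_right (m := ∞) (by simp)).differentiableAt
      (by simp)).hasFDerivAt.clm_apply (hasFDerivAt_const v y)
    have hmetric := hG.fderiv_apply_apply hy hl (differentiableAt_const v) u
    rw [← hfst.fderiv_eq, happly.fderiv] at hmetric
    simpa [cov_apply] using hmetric
  have hsymm := (isSymmSndFDerivAt_of_smooth hT).eq u v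
  rw [hhessian, hhessian, hG.leviCivita_symm hy u v] at hsymm
  exact add_right_cancel hsymm

end IsMetricOn

namespace IsSinyukovSolution

variable {a : E → E →L[ℝ] E} {l φ : E → E} (ha : IsSinyukovSolution G a l Ω) (hG : IsMetricOn G Ω)
  (hy : y ∈ Ω)
include ha hG hy

lemma cov_cov_endo_const (u v x : E) :
    cov G (fun z ↦ cov G (fun z ↦ a z x) z v) y u =
      (G y (cov G l y u) x + G y (l y) (cov G (fun _ ↦ x) y u)) • v
      + G y (l y) x • cov G (fun _ ↦ v) y u
      + ((G y (cov G (fun _ ↦ x) y u) v + G y x (cov G (fun _ ↦ v) y u)) • l y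
      + G y x v • cov G l y u)
      + (G y (l y) (cov G (fun _ ↦ x) y v) • u + G y (cov G (fun _ ↦ x) y v) u • l y
      + a y (cov G (fun z ↦ cov G (fun _ ↦ x) z v) y u)) := by
  have hx := hG.differentiableAt_cov_apply hy (contDiffAt_const (c := x)) v
  have hay := ha.differentiableAt_endo hy
  have hly := ha.differentiableAt_grad hy
  have hGy := hG.differentiableAt hy
  have hlx : DifferentiableAt ℝ (fun z ↦ G z (l z) x) y :=
    (hGy.clm_apply hly).clm_apply (differentiableAt_const x)
  have hxv : DifferentiableAt ℝ (fun z ↦ G z x v) y :=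
    (hGy.clm_apply (differentiableAt_const x)).clm_apply (differentiableAt_const v)
  have hev : (fun z ↦ cov G (fun z ↦ a z x) z v) =ᶠ[𝓝 y]
      fun z ↦ G z (l z) x • v + G z x v • l z + a z (cov G (fun _ ↦ x) z v) := by
    filter_upwards [hG.isOpen.mem_nhds hy] with z hz using
      ha.cov_endo_apply hz (differentiableAt_const x) v
  have hlxv : DifferentiableAt ℝ (fun z ↦ G z (l z) x • v) y := hlx.smul_const v
  have hxvl : DifferentiableAt ℝ (fun z ↦ G z x v • l z) y := hxv.smul hly
  rw [cov_congr hev, cov_add (hlxv.fun_add hxvl) (hay.clm_apply hx), cov_add hlxv hxvl,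
    cov_smul hlx (differentiableAt_const v), cov_smul hxv hly, ha.cov_endo_apply hy hx,
    hG.fderiv_apply_apply hy hly (differentiableAt_const x),
    hG.fderiv_apply_apply hy (differentiableAt_const x) (differentiableAt_const v)]
  module

lemma curvature_endo_sub (u v x : E) :
    curvature G y u v (a y x) - a y (curvature G y u v x) =
      G y (cov G l y u) x • v - G y (cov G l y v) x • u
        + (G y x v • cov G l y u - G y x u • cov G l y v) := by
  have htorsion : cov G (fun _ ↦ v) y u = cov G (fun _ ↦ u) y v := by
    simp [cov_apply, hG.leviCivita_symm hy u v]
  rw [← hG.cov_cov_sub_cov_cov hy ((ha.contDiffAt_endo y hy).clm_apply (contDiffAt_const (c := x))),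
    ← hG.cov_cov_sub_cov_cov hy (contDiffAt_const (c := x)), ha.cov_cov_endo_const hG hy,
    ha.cov_cov_endo_const hG hy, htorsion, map_sub]
  module

lemma exists_cov_eq_smul (hφ : ContDiffAt ℝ ∞ φ y) (hφcov : ∀ z ∈ Ω, cov G φ z = 0)
    (hφ₀ : φ y ≠ 0) : ∃ μ : ℝ, ∀ v, cov G l y v = μ • v := by
  have hGy := hG.isMetricForm y hy
  have hT : ContDiffAt ℝ ∞ (fun z ↦ (1 / 2 : ℝ) * traceL E (a z)) y :=
    contDiffAt_const.mul ((traceL E).contDiff.contDiffAt.comp y (ha.contDiffAt_endo y hy))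
  refine hGy.exists_eq_smul_of_apply_add_apply hφ₀ (L := cov G l y)
    (hG.cov_symm_of_eq_fderiv hy hT (ha.differentiableAt_grad hy) fun z hz ↦ ha.apply_grad hG hz)
    fun v x z ↦ ?_
  have hcurvature := ha.curvature_endo_sub hG hy (φ y) v x
  rw [hG.curvature_parallel_left hy hφ hφcov, hG.curvature_parallel_left hy hφ hφcov, map_zero,
    sub_zero] at hcurvature
  have hz := congrArg (fun w ↦ G y w z) hcurvature
  simp only [map_zero, zero_apply, map_add, map_sub, map_smul, add_apply, sub_apply, smul_apply,
    smul_eq_mul] at hz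
  linear_combination -hz

end IsSinyukovSolution

end Curvature

/-! ### Concircular fields obtained from a parallel field -/

section Powers

variable {E : Type*} [NormedAddCommGroup E] [NormedSpace ℝ E] {a : E →L[ℝ] E}

lemma pow_succ_apply (a : E →L[ℝ] E) (k : ℕ) (x : E) : (a ^ (k + 1)) x = a ((a ^ k) x) := by
  rw [pow_succ', mul_apply_eq_comp]

lemma apply_pow_of_selfAdjoint {B : E →L[ℝ] E →L[ℝ] ℝ} (ha : ∀ x z, B (a x) z = B x (a z)) (k : ℕ)
    (x z : E) : B ((a ^ k) x) z = B x ((a ^ k) z) := by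
  induction k generalizing x z with
  | zero => rfl
  | succ k ih => rw [pow_succ_apply, ha, ih, pow_succ, mul_apply_eq_comp]

lemma apply_eq_zero_of_pow_succ [FiniteDimensional ℝ E] (ha : Function.Injective a)
    {ℓ : E →L[ℝ] ℝ} {x : E} (h : ∀ k, ℓ ((a ^ (k + 1)) x) = 0) : ℓ x = 0 := by
  let W : Submodule ℝ E := ⨅ k : ℕ, LinearMap.ker (ℓ.comp (a ^ k) : E →ₗ[ℝ] ℝ)
  have hW : ∀ w, w ∈ W ↔ ∀ k, ℓ ((a ^ k) w) = 0 := fun w ↦ Submodule.mem_iInf _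
  have hpow : ∀ k w, (a ^ k) (a w) = (a ^ (k + 1)) w := fun k w ↦ by
    rw [pow_succ, mul_apply_eq_comp]
  have hmaps : ∀ w ∈ W, (a : E →ₗ[ℝ] E) w ∈ W := fun w hw ↦
    (hW _).2 fun k ↦ (congrArg ℓ (hpow k w)).trans ((hW w).1 hw (k + 1))
  have hinj : Function.Injective ((a : E →ₗ[ℝ] E).restrict hmaps) := fun u v huv ↦
    Subtype.ext (ha (congrArg Subtype.val huv))
  have hax : a x ∈ W := (hW _).2 fun k ↦ by rw [hpow, h]
  obtain ⟨⟨w, hw⟩, hwx⟩ := LinearMap.injective_iff_surjective.1 hinj ⟨a x, hax⟩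
  rw [← ha (congrArg Subtype.val hwx)]
  exact (hW w).1 hw 0

end Powers

namespace IsSinyukovSolution

variable {E : Type*} [NormedAddCommGroup E] [NormedSpace ℝ E]
  {G : E → E →L[ℝ] E →L[ℝ] ℝ} {Ω : Set E} {y : E} {a : E → E →L[ℝ] E} {l φ : E → E} {k : ℕ}

lemma cov_pow_zero_apply (hφcov : cov G φ y = 0) (v : E) :
    cov G (fun z ↦ (a z ^ 0) (φ z)) y v = 0 := by
  simp only [pow_zero, one_apply_eq_self, hφcov, zero_apply]

variable (ha : IsSinyukovSolution G a l Ω) (hG : IsMetricOn G Ω) (hy : y ∈ Ω)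
  (hφ : DifferentiableAt ℝ φ y)

include ha hy hφ in
lemma differentiableAt_pow_apply (j : ℕ) : DifferentiableAt ℝ (fun z ↦ (a z ^ j) (φ z)) y :=
  ((ha.differentiableAt_endo hy).pow j).clm_apply hφ

include ha hG hy in
lemma apply_pow_grad (i : ℕ) (x : E) : G y ((a y ^ i) (l y)) x = G y ((a y ^ i) x) (l y) := by
  rw [apply_pow_of_selfAdjoint (ha.selfAdjoint y hy), (hG.isMetricForm y hy).symm]

include ha hG hy hφ

lemma apply_pow_cov_pow_succ (m j : ℕ) (v w : E) :
    G y ((a y ^ m) (cov G (fun z ↦ (a z ^ (j + 1)) (φ z)) y v)) w =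
      G y ((a y ^ j) (φ y)) (l y) * G y ((a y ^ m) v) w
        + G y ((a y ^ j) (φ y)) v * G y ((a y ^ m) (l y)) w
        + G y ((a y ^ (m + 1)) (cov G (fun z ↦ (a z ^ j) (φ z)) y v)) w := by
  simp only [pow_succ_apply (a _) j]
  rw [ha.cov_endo_apply hy (ha.differentiableAt_pow_apply hy hφ j), pow_succ (a y) m,
    mul_apply_eq_comp, (hG.isMetricForm y hy).symm (l y)]
  simp only [map_add, map_smul, add_apply, smul_apply, smul_eq_mul]

variable (hφcov : cov G φ y = 0) (hφl : ∀ i < k, G y ((a y ^ i) (φ y)) (l y) = 0)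

include hφcov hφl

lemma apply_pow_cov_pow_grad (hl : ∀ i < k, G y ((a y ^ i) (l y)) (l y) = 0) (v : E) (j m : ℕ)
    (hjm : j + m ≤ k) :
    G y ((a y ^ m) (cov G (fun z ↦ (a z ^ j) (φ z)) y v)) (l y) = 0 := by
  induction j generalizing m with
  | zero => rw [cov_pow_zero_apply hφcov, map_zero, map_zero, zero_apply]
  | succ j ih =>
    rw [ha.apply_pow_cov_pow_succ hG hy hφ, hφl j (by lia), hl m (by lia), ih (m + 1) (by lia)]
    ring

lemma apply_pow_cov_pow_field (v : E) (j m : ℕ) (hjm : j + m + 1 = k) :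
    G y ((a y ^ (m + 1)) (cov G (fun z ↦ (a z ^ (j + 1)) (φ z)) y v)) (φ y) =
      G y ((a y ^ k) (φ y)) (l y) * G y (φ y) v := by
  rw [ha.apply_pow_cov_pow_succ hG hy hφ, hφl j (by lia), ha.apply_pow_grad hG hy]
  induction j generalizing m with
  | zero =>
    rw [cov_pow_zero_apply hφcov, map_zero, map_zero, zero_apply, pow_zero, one_apply_eq_self,
      ← hjm, zero_add]
    ring
  | succ j ih =>
    rw [ha.apply_pow_cov_pow_succ hG hy hφ, hφl j (by lia), ha.apply_pow_grad hG hy,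
      hφl (m + 1) (by lia), ← ih (m + 1) (by lia)]
    ring

lemma apply_cov_pow_succ_field (v : E) :
    G y (cov G (fun z ↦ (a z ^ (k + 1)) (φ z)) y v) (φ y) =
      2 * G y ((a y ^ k) (φ y)) (l y) * G y (φ y) v := by
  have hsymm := (hG.isMetricForm y hy).symm
  have hexpand := ha.apply_pow_cov_pow_succ hG hy hφ 0 k v (φ y)
  simp only [pow_zero, one_apply_eq_self, zero_add] at hexpand
  rw [hexpand, hsymm (l y), hsymm v]
  cases k with
  | zero =>
    rw [cov_pow_zero_apply hφcov, map_zero, map_zero, zero_apply, pow_zero, one_apply_eq_self]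
    ring
  | succ k =>
    have hφl₀ : G y (φ y) (l y) = 0 := hφl 0 (by lia)
    have hfield := ha.apply_pow_cov_pow_field hG hy hφ hφcov hφl v k 0 rfl
    rw [zero_add] at hfield
    rw [hφl₀, hfield]
    ring

end IsSinyukovSolution

/-- The vector field `2 G(a ^ k φ, l) a φ - G(a ^ (k + 1) φ, φ) l`, which is concircular if `φ` is
parallel, `a` and `l` solve the Sinyukov equation and `G(a ^ i φ, l) = 0` for all `i < k`. -/
def combinedField {E : Type*} [NormedAddCommGroup E] [NormedSpace ℝ E] (B : E →L[ℝ] E →L[ℝ] ℝ)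
    (a : E →L[ℝ] E) (l φ : E) (k : ℕ) : E :=
  (2 * B ((a ^ k) φ) l) • a φ - B ((a ^ (k + 1)) φ) φ • l

section Combined

variable {E : Type*} [NormedAddCommGroup E] [NormedSpace ℝ E] [FiniteDimensional ℝ E]
  {G : E → E →L[ℝ] E →L[ℝ] ℝ} {Ω : Set E} {y : E} {a : E → E →L[ℝ] E} {l φ : E → E} {k : ℕ}

lemma IsSinyukovSolution.cov_combinedField (ha : IsSinyukovSolution G a l Ω) (hG : IsMetricOn G Ω)
    (hy : y ∈ Ω) (hφ : DifferentiableAt ℝ φ y) (hφcov : cov G φ y = 0)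
    (hφl : ∀ i < k, G y ((a y ^ i) (φ y)) (l y) = 0)
    (hl : φ y ≠ 0 → cov G l y = 0 ∧ ∀ i < k, G y ((a y ^ i) (l y)) (l y) = 0) (v : E) :
    cov G (fun z ↦ combinedField (G z) (a z) (l z) (φ z) k) y v =
      (2 * G y ((a y ^ k) (φ y)) (l y) * G y (φ y) (l y)) • v := by
  have hX := ha.differentiableAt_pow_apply hy hφ
  have hay := ha.differentiableAt_endo hy
  have hly := ha.differentiableAt_grad hy
  have hc : DifferentiableAt ℝ (fun z ↦ G z ((a z ^ k) (φ z)) (l z)) y :=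
    ((hG.differentiableAt hy).clm_apply (hX k)).clm_apply hly
  have hd : DifferentiableAt ℝ (fun z ↦ G z ((a z ^ (k + 1)) (φ z)) (φ z)) y :=
    ((hG.differentiableAt hy).clm_apply (hX (k + 1))).clm_apply hφ
  have hleft : DifferentiableAt ℝ (fun z ↦ (2 * G z ((a z ^ k) (φ z)) (l z)) • a z (φ z)) y :=
    (hc.const_mul 2).smul (hay.clm_apply hφ)
  have hright : DifferentiableAt ℝ (fun z ↦ G z ((a z ^ (k + 1)) (φ z)) (φ z) • l z) y :=
    hd.smul hly
  simp only [combinedField]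
  rw [cov_sub hleft hright, cov_smul (hc.const_mul 2) (hay.clm_apply hφ), cov_smul hd hly,
    ha.cov_endo_apply hy hφ, hφcov, fderiv_const_mul hc, smul_apply,
    hG.fderiv_apply_apply hy (hX k) hly, hG.fderiv_apply_apply hy (hX (k + 1)) hφ, hφcov]
  simp only [zero_apply, map_zero, add_zero]
  by_cases hφ₀ : φ y = 0
  · simp only [hφ₀, map_zero, zero_apply, mul_zero, zero_smul, smul_zero, add_zero, sub_zero]
  · obtain ⟨hlcov, hll⟩ := hl hφ₀
    have hgrad := ha.apply_pow_cov_pow_grad hG hy hφ hφcov hφl hll v k 0 (by lia)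
    rw [pow_zero, one_apply_eq_self] at hgrad
    rw [hgrad, ha.apply_cov_pow_succ_field hG hy hφ hφcov hφl, hlcov, zero_apply, map_zero,
      (hG.isMetricForm y hy).symm (l y) (φ y)]
    module

end Combined

/-! ### Smooth charts of a manifold -/

section Charts

variable {E : Type*} [NormedAddCommGroup E] [NormedSpace ℝ E] {M : Type*} [TopologicalSpace M]
  [ChartedSpace E M]

/-- The derivative at `y` of the parametrization `e.symm` of `M`. -/
def paramDeriv (e : OpenPartialHomeomorph M E) (y : E) : E →L[ℝ] E :=
  mfderiv 𝓘(ℝ, E) 𝓘(ℝ, E) e.symm y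

/-- A field of bilinear forms on the tangent spaces of `M`, read in the chart `e`. -/
def formIn (B : M → E →L[ℝ] E →L[ℝ] ℝ) (e : OpenPartialHomeomorph M E) (y : E) :
    E →L[ℝ] E →L[ℝ] ℝ :=
  (B (e.symm y)).bilinearComp (paramDeriv e y) (paramDeriv e y)

/-- A vector field on `M`, read in the chart `e`. -/
def fieldIn (V : M → E) (e : OpenPartialHomeomorph M E) (y : E) : E :=
  (paramDeriv e y).inverse (V (e.symm y))

/-- A smooth pseudo-Riemannian metric on `M`, given by its values on the tangent spaces. -/
def IsMetricField (B : M → E →L[ℝ] E →L[ℝ] ℝ) : Prop :=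
  ∀ e ∈ maximalAtlas 𝓘(ℝ, E) ∞ M, IsMetricOn (formIn B e) e.target

variable {B : M → E →L[ℝ] E →L[ℝ] ℝ} {V W : M → E} {e e' : OpenPartialHomeomorph M E} {y : E}

lemma fieldIn_smul (c : M → ℝ) (V : M → E) (e : OpenPartialHomeomorph M E) (y : E) :
    fieldIn (fun x ↦ c x • V x) e y = c (e.symm y) • fieldIn V e y :=
  map_smul (paramDeriv e y).inverse _ _

lemma fieldIn_sub (V W : M → E) (e : OpenPartialHomeomorph M E) (y : E) :
    fieldIn (fun x ↦ V x - W x) e y = fieldIn V e y - fieldIn W e y :=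
  map_sub (paramDeriv e y).inverse _ _

/-- The differential of a function on `M`, as a linear form on the model space. -/
def dFun (F : M → ℝ) (x : M) : E →L[ℝ] ℝ :=
  mfderiv 𝓘(ℝ, E) 𝓘(ℝ, ℝ) F x

lemma mdifferentiable_of_mem_maximalAtlas (he : e ∈ maximalAtlas 𝓘(ℝ, E) ∞ M) :
    e.MDifferentiable 𝓘(ℝ, E) 𝓘(ℝ, E) :=
  ⟨(contMDiffOn_of_mem_maximalAtlas he).mdifferentiableOn (by simp),
    (contMDiffOn_symm_of_mem_maximalAtlas he).mdifferentiableOn (by simp)⟩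

section Target

variable (he : e ∈ maximalAtlas 𝓘(ℝ, E) ∞ M) (hy : y ∈ e.target)

include he hy

lemma isInvertible_paramDeriv : (paramDeriv e y).IsInvertible :=
  ⟨(mdifferentiable_of_mem_maximalAtlas he).symm.mfderiv hy, rfl⟩

lemma paramDeriv_fieldIn (V : M → E) : paramDeriv e y (fieldIn V e y) = V (e.symm y) :=
  (isInvertible_paramDeriv he hy).self_apply_inverse _

lemma fieldIn_eq_iff {w : E} : fieldIn V e y = w ↔ V (e.symm y) = paramDeriv e y w := by
  rw [← (isInvertible_paramDeriv he hy).injective.eq_iff, paramDeriv_fieldIn he hy]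

lemma fieldIn_eq_zero_iff : fieldIn V e y = 0 ↔ V (e.symm y) = 0 := by
  rw [fieldIn_eq_iff he hy, map_zero]

lemma fieldIn_eq_mfderiv (V : M → E) :
    fieldIn V e y = mfderiv 𝓘(ℝ, E) 𝓘(ℝ, E) e (e.symm y) (V (e.symm y)) := by
  have hcomp := (mdifferentiable_of_mem_maximalAtlas he).symm_comp_deriv (e.map_target hy)
  rw [e.right_inv hy] at hcomp
  exact (fieldIn_eq_iff he hy).2 (DFunLike.congr_fun hcomp (V _)).symm

lemma formIn_apply_fieldIn (B : M → E →L[ℝ] E →L[ℝ] ℝ) (V W : M → E) :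
    formIn B e y (fieldIn V e y) (fieldIn W e y) = B (e.symm y) (V (e.symm y)) (W (e.symm y)) := by
  rw [← paramDeriv_fieldIn he hy V, ← paramDeriv_fieldIn he hy W]
  rfl

lemma fderiv_comp_symm {F : M → ℝ} (hF : MDifferentiableAt 𝓘(ℝ, E) 𝓘(ℝ, ℝ) F (e.symm y)) :
    fderiv ℝ (fun z ↦ F (e.symm z)) y = (dFun F (e.symm y)).comp (paramDeriv e y) := by
  have hparam := (mdifferentiable_of_mem_maximalAtlas he).mdifferentiableAt_symm hy
  have hcomp : HasFDerivAt (fun z ↦ F (e.symm z)) ((dFun F (e.symm y)).comp (paramDeriv e y)) y :=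
    hasMFDerivAt_iff_hasFDerivAt.1 (hF.hasMFDerivAt.comp y hparam.hasMFDerivAt)
  exact hcomp.fderiv

end Target

variable [IsManifold 𝓘(ℝ, E) ∞ M]

lemma exists_mem_target (x : M) :
    ∃ e ∈ maximalAtlas 𝓘(ℝ, E) ∞ M, ∃ y ∈ e.target, e.symm y = x :=
  ⟨chartAt E x, chart_mem_maximalAtlas x, chartAt E x x, mem_chart_target E x,
    (chartAt E x).left_inv (mem_chart_source E x)⟩

lemma paramDeriv_chartAt_self (x : M) : paramDeriv (chartAt E x) (chartAt E x x) = .id ℝ E := by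
  have hself := mfderivWithin_range_extChartAt_symm (I := 𝓘(ℝ, E)) (x := x)
  rw [ModelWithCorners.range_eq_univ, mfderivWithin_univ] at hself
  exact hself

lemma fieldIn_chartAt_self (V : M → E) (x : M) :
    fieldIn V (chartAt E x) (chartAt E x x) = V x := by
  rw [fieldIn, paramDeriv_chartAt_self, ContinuousLinearMap.inverse_id,
    ContinuousLinearMap.id_apply, (chartAt E x).left_inv (mem_chart_source E x)]

lemma contMDiff_of_contDiffOn_comp_symm {F : M → ℝ}
    (hF : ∀ e ∈ maximalAtlas 𝓘(ℝ, E) ∞ M, ContDiffOn ℝ ∞ (fun z ↦ F (e.symm z)) e.target) :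
    ContMDiff 𝓘(ℝ, E) 𝓘(ℝ, ℝ) ∞ F := by
  intro x
  set e := chartAt E x
  have he : e ∈ maximalAtlas 𝓘(ℝ, E) ∞ M := chart_mem_maximalAtlas x
  have hFe := ((hF e he).contDiffAt (e.open_target.mem_nhds (mem_chart_target E x))).contMDiffAt
  refine (hFe.comp x (contMDiffAt_of_mem_maximalAtlas he (mem_chart_source E x)))
    |>.congr_of_eventuallyEq ?_
  filter_upwards [e.open_source.mem_nhds (mem_chart_source E x)] with x' hx'
  rw [Function.comp_apply, e.left_inv hx']

lemma contMDiffOn_paramDeriv (he : e ∈ maximalAtlas 𝓘(ℝ, E) ∞ M) {W : E → E}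
    (hW : ContDiffOn ℝ ∞ W e.target) :
    ContMDiffOn 𝓘(ℝ, E) 𝓘(ℝ, E).tangent ∞
      (fun z ↦ (⟨e.symm z, paramDeriv e z (W z)⟩ : TangentBundle 𝓘(ℝ, E) M)) e.target := by
  have htangent := (contMDiffOn_symm_of_mem_maximalAtlas he).contMDiffOn_tangentMapWithin
    (m := ∞) (by simp) e.open_target.uniqueMDiffOn
  have hsection : ContMDiffOn 𝓘(ℝ, E) 𝓘(ℝ, E).tangent ∞
      (fun z ↦ (⟨z, W z⟩ : TangentBundle 𝓘(ℝ, E) E)) e.target :=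
    contMDiffOn_vectorSpace_iff_contDiffOn.2 hW
  refine (htangent.comp hsection fun z hz ↦ hz).congr fun z hz ↦ ?_
  rw [Function.comp_apply, tangentMapWithin, mfderivWithin_of_isOpen e.open_target hz]
  rfl

lemma contDiffAt_fieldIn [CompleteSpace E] (he : e ∈ maximalAtlas 𝓘(ℝ, E) ∞ M)
    (hy : y ∈ e.target) {V : M → E}
    (hV : ContMDiffAt 𝓘(ℝ, E) 𝓘(ℝ, E).tangent ∞
      (fun x ↦ (⟨x, V x⟩ : TangentBundle 𝓘(ℝ, E) M)) (e.symm y)) :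
    ContDiffAt ℝ ∞ (fieldIn V e) y := by
  have hinv := isInvertible_paramDeriv he hy
  have hpull := ContMDiffAt.mpullback_vectorField_preimage (n := ∞) (m := ∞) hV
    (contMDiffAt_symm_of_mem_maximalAtlas he hy) hinv (by simp)
  rw [contMDiffAt_vectorSpace_iff_contDiffAt] at hpull
  exact hpull

lemma contMDiff_of_contDiffOn_fieldIn
    (hV : ∀ e ∈ maximalAtlas 𝓘(ℝ, E) ∞ M, ContDiffOn ℝ ∞ (fieldIn V e) e.target) :
    ContMDiff 𝓘(ℝ, E) 𝓘(ℝ, E).tangent ∞ (fun x ↦ (⟨x, V x⟩ : TangentBundle 𝓘(ℝ, E) M)) := by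
  intro x
  set e := chartAt E x
  have he : e ∈ maximalAtlas 𝓘(ℝ, E) ∞ M := chart_mem_maximalAtlas x
  have hpush := (contMDiffOn_paramDeriv he (hV e he)).contMDiffAt
    (e.open_target.mem_nhds (mem_chart_target E x))
  refine (hpush.comp x (contMDiffAt_of_mem_maximalAtlas he (mem_chart_source E x)))
    |>.congr_of_eventuallyEq ?_
  filter_upwards [e.open_source.mem_nhds (mem_chart_source E x)] with x' hx'
  rw [Function.comp_apply, paramDeriv_fieldIn he (e.map_source hx'), e.left_inv hx']

lemma IsMetricField.isMetricForm (hB : IsMetricField B) (x : M) : IsMetricForm (B x) := by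
  obtain ⟨e, he, y, hy, rfl⟩ := exists_mem_target (E := E) x
  obtain ⟨L, hL⟩ := isInvertible_paramDeriv he hy
  have hform : B (e.symm y) =
      (formIn B e y).bilinearComp (L.symm : E →L[ℝ] E) (L.symm : E →L[ℝ] E) := by
    ext u v
    simp [formIn, ← hL]
  exact hform ▸ ((hB e he).isMetricForm y hy).bilinearComp ⟨L.symm, rfl⟩

end Charts

section Transition

lemma eventually_mem_target_and_source {X Y : Type*} [TopologicalSpace X] [TopologicalSpace Y]
    {e e' : OpenPartialHomeomorph X Y} {y : Y} (hy : y ∈ e.target) (hy' : e.symm y ∈ e'.source) :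
    ∀ᶠ z in 𝓝 y, z ∈ e.target ∧ e.symm z ∈ e'.source :=
  (e.open_target.eventually_mem hy).and
    ((e.continuousAt_symm hy).eventually_mem (e'.open_source.mem_nhds hy'))

variable {E : Type*} [NormedAddCommGroup E] [NormedSpace ℝ E] {M : Type*} [TopologicalSpace M]
  [ChartedSpace E M] {e e' : OpenPartialHomeomorph M E} {y : E}
  (he : e ∈ maximalAtlas 𝓘(ℝ, E) ∞ M) (he' : e' ∈ maximalAtlas 𝓘(ℝ, E) ∞ M) (hy : y ∈ e.target)
  (hy' : e.symm y ∈ e'.source)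

include he he' hy hy'

lemma contDiffAt_transition : ContDiffAt ℝ ∞ (e' ∘ e.symm) y :=
  contMDiffAt_iff_contDiffAt.1 <|
    (contMDiffAt_of_mem_maximalAtlas he' hy').comp y (contMDiffAt_symm_of_mem_maximalAtlas he hy)

lemma paramDeriv_comp_fderiv_transition :
    (paramDeriv e' (e' (e.symm y))).comp (fderiv ℝ (e' ∘ e.symm) y) = paramDeriv e y := by
  have hparam' := ((mdifferentiable_of_mem_maximalAtlas he').mdifferentiableAt_symm
    (e'.map_source hy')).hasMFDerivAt
  have hτ := ((contDiffAt_transition he he' hy hy').differentiableAt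
    (by simp)).hasFDerivAt.hasMFDerivAt
  have hparam := ((mdifferentiable_of_mem_maximalAtlas he).mdifferentiableAt_symm hy).hasMFDerivAt
  have heq : e'.symm ∘ (e' ∘ e.symm) =ᶠ[𝓝 y] e.symm := by
    filter_upwards [(e.continuousAt_symm hy).eventually_mem (e'.open_source.mem_nhds hy')] with z hz
    exact e'.left_inv hz
  exact hasMFDerivAt_unique (HasMFDerivAt.comp y hparam' hτ) (hparam.congr_of_eventuallyEq heq)

lemma isInvertible_fderiv_transition : (fderiv ℝ (e' ∘ e.symm) y).IsInvertible := by
  obtain ⟨L, hL⟩ := isInvertible_paramDeriv he hy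
  obtain ⟨L', hL'⟩ := isInvertible_paramDeriv he' (e'.map_source hy')
  have hcomp := paramDeriv_comp_fderiv_transition he he' hy hy'
  refine ⟨L.trans L'.symm, ?_⟩
  ext v
  have hv := DFunLike.congr_fun hcomp v
  rw [← hL, ← hL', ContinuousLinearMap.comp_apply] at hv
  exact (L'.eq_symm_apply.2 hv).symm

lemma isIsometryAt_transition (B : M → E →L[ℝ] E →L[ℝ] ℝ) :
    IsIsometryAt (formIn B e) (formIn B e') (e' ∘ e.symm) y where
  contDiffAt := contDiffAt_transition he he' hy hy'
  isInvertible := isInvertible_fderiv_transition he he' hy hy'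
  eventually_eq := by
    filter_upwards [eventually_mem_target_and_source hy hy'] with z ⟨hz, hz'⟩
    rw [formIn, formIn, ← paramDeriv_comp_fderiv_transition he he' hz hz', Function.comp_apply,
      e'.left_inv hz']
    rfl

lemma fieldIn_transition (V : M → E) :
    fieldIn V e' ((e' ∘ e.symm) y) = fderiv ℝ (e' ∘ e.symm) y (fieldIn V e y) := by
  rw [Function.comp_apply, fieldIn_eq_iff he' (e'.map_source hy'), e'.left_inv hy',
    ← ContinuousLinearMap.comp_apply, paramDeriv_comp_fderiv_transition he he' hy hy',
    paramDeriv_fieldIn he hy]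

lemma cov_fieldIn_transition [FiniteDimensional ℝ E] {B : M → E →L[ℝ] E →L[ℝ] ℝ}
    (hB : IsMetricField B) {V : M → E}
    (hV : ∀ e ∈ maximalAtlas 𝓘(ℝ, E) ∞ M, ContDiffOn ℝ ∞ (fieldIn V e) e.target) (r : ℝ)
    (hcov : cov (formIn B e) (fieldIn V e) y = r • .id ℝ E) :
    cov (formIn B e') (fieldIn V e') (e' (e.symm y)) = r • .id ℝ E := by
  have hV_at : ∀ e ∈ maximalAtlas 𝓘(ℝ, E) ∞ M, ∀ z ∈ e.target,
      DifferentiableAt ℝ (fieldIn V e) z := fun e he z hz ↦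
    ((hV e he).contDiffAt (e.open_target.mem_nhds hz)).differentiableAt (by simp)
  have hτ := isIsometryAt_transition he he' hy hy' B
  have hfield : ∀ᶠ z in 𝓝 y,
      fieldIn V e' ((e' ∘ e.symm) z) = fderiv ℝ (e' ∘ e.symm) z (fieldIn V e z) := by
    filter_upwards [eventually_mem_target_and_source hy hy'] with z ⟨hz, hz'⟩
    exact fieldIn_transition he he' hz hz' V
  ext1 u'
  obtain ⟨u, rfl⟩ := hτ.isInvertible.surjective u'
  have hmap := hτ.map_cov (hB e he) hy (hB e' he') (e'.map_source hy') (hV_at e he y hy)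
    (hV_at e' he' _ (e'.map_source hy')) hfield u
  rw [hcov, smul_apply, map_smul] at hmap
  exact hmap.symm

end Transition

/-! ### Concircular fields and solutions of the Sinyukov equation on a manifold -/

section Concircular

variable {E : Type*} [NormedAddCommGroup E] [NormedSpace ℝ E] {M : Type*} [TopologicalSpace M]
  [ChartedSpace E M]

/-- A vector field on `M` which is smooth and, in every chart, concircular. -/
structure IsConcircularField (G : M → E →L[ℝ] E →L[ℝ] ℝ) (V : M → E) : Prop where
  contDiffOn : ∀ e ∈ maximalAtlas 𝓘(ℝ, E) ∞ M, ContDiffOn ℝ ∞ (fieldIn V e) e.target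
  exists_cov_eq : ∀ e ∈ maximalAtlas 𝓘(ℝ, E) ∞ M, ∀ y ∈ e.target,
    ∃ r : ℝ, cov (formIn G e) (fieldIn V e) y = r • .id ℝ E

/-- Parallel vector fields: those with vanishing covariant derivative. -/
def IsParallelField (G : M → E →L[ℝ] E →L[ℝ] ℝ) (V : M → E) : Prop :=
  ∀ e ∈ maximalAtlas 𝓘(ℝ, E) ∞ M, ∀ y ∈ e.target, cov (formIn G e) (fieldIn V e) y = 0

/-- The metrics all of whose concircular fields are of the exceptional type, that is, parallel. The
zero field counts as concircular here. -/
def IsExceptionalMetric (G : M → E →L[ℝ] E →L[ℝ] ℝ) : Prop :=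
  ∀ V, IsConcircularField G V → IsParallelField G V

/-- A field of endomorphisms of the tangent spaces of `M`, read in the chart `e`. -/
def endoIn (a : M → E →L[ℝ] E) (e : OpenPartialHomeomorph M E) (y : E) : E →L[ℝ] E :=
  (paramDeriv e y).inverse.comp ((a (e.symm y)).comp (paramDeriv e y))

/-- A global solution `(a, l)` of the Sinyukov equation of the metric `G`. -/
def IsSinyukovPair (G : M → E →L[ℝ] E →L[ℝ] ℝ) (a : M → E →L[ℝ] E) (l : M → E) : Prop :=
  ∀ e ∈ maximalAtlas 𝓘(ℝ, E) ∞ M,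
    IsSinyukovSolution (formIn G e) (endoIn a e) (fieldIn l e) e.target

variable {G : M → E →L[ℝ] E →L[ℝ] ℝ} {a : M → E →L[ℝ] E} {l V : M → E}
  {e : OpenPartialHomeomorph M E} {y : E}

lemma IsConcircularField.contDiffAt (hV : IsConcircularField G V)
    (he : e ∈ maximalAtlas 𝓘(ℝ, E) ∞ M) (hy : y ∈ e.target) : ContDiffAt ℝ ∞ (fieldIn V e) y :=
  (hV.contDiffOn e he).contDiffAt (e.open_target.mem_nhds hy)

lemma IsConcircularField.differentiableAt (hV : IsConcircularField G V)
    (he : e ∈ maximalAtlas 𝓘(ℝ, E) ∞ M) (hy : y ∈ e.target) :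
    DifferentiableAt ℝ (fieldIn V e) y :=
  (hV.contDiffAt he hy).differentiableAt (by simp)

lemma isConcircularField_of_eventuallyEq
    (h : ∀ e ∈ maximalAtlas 𝓘(ℝ, E) ∞ M, ∀ y ∈ e.target, ∃ W : E → E, fieldIn V e =ᶠ[𝓝 y] W ∧
      ContDiffAt ℝ ∞ W y ∧ ∃ r : ℝ, cov (formIn G e) W y = r • .id ℝ E) :
    IsConcircularField G V where
  contDiffOn e he y hy := by
    obtain ⟨W, hVW, hW, -⟩ := h e he y hy
    exact (hW.congr_of_eventuallyEq hVW).contDiffWithinAt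
  exists_cov_eq e he y hy := by
    obtain ⟨W, hVW, -, r, hr⟩ := h e he y hy
    exact ⟨r, (cov_congr hVW).trans hr⟩

section Target

variable (he : e ∈ maximalAtlas 𝓘(ℝ, E) ∞ M) (hy : y ∈ e.target)

include he hy

lemma fieldIn_endo (a : M → E →L[ℝ] E) (V : M → E) :
    fieldIn (fun x ↦ a x (V x)) e y = endoIn a e y (fieldIn V e y) := by
  rw [endoIn, ContinuousLinearMap.comp_apply, ContinuousLinearMap.comp_apply,
    paramDeriv_fieldIn he hy]
  rfl

lemma fieldIn_endo_pow (a : M → E →L[ℝ] E) (V : M → E) (k : ℕ) :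
    fieldIn (fun x ↦ (a x ^ k) (V x)) e y = (endoIn a e y ^ k) (fieldIn V e y) := by
  induction k with
  | zero => rfl
  | succ k ih =>
    simp only [pow_succ_apply]
    rw [← ih, ← fieldIn_endo he hy]

lemma formIn_pow_apply_fieldIn (G : M → E →L[ℝ] E →L[ℝ] ℝ) (a : M → E →L[ℝ] E) (V W : M → E)
    (k : ℕ) : formIn G e y ((endoIn a e y ^ k) (fieldIn V e y)) (fieldIn W e y) =
      G (e.symm y) ((a (e.symm y) ^ k) (V (e.symm y))) (W (e.symm y)) := by
  rw [← fieldIn_endo_pow he hy, formIn_apply_fieldIn he hy]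

lemma fieldIn_combinedField (G : M → E →L[ℝ] E →L[ℝ] ℝ) (a : M → E →L[ℝ] E) (l V : M → E) (k : ℕ) :
    fieldIn (fun x ↦ combinedField (G x) (a x) (l x) (V x) k) e y =
      combinedField (formIn G e y) (endoIn a e y) (fieldIn l e y) (fieldIn V e y) k := by
  rw [combinedField, formIn_pow_apply_fieldIn he hy, formIn_pow_apply_fieldIn he hy,
    ← fieldIn_endo he hy]
  exact (fieldIn_sub _ _ e y).trans (congrArg₂ _ (fieldIn_smul _ _ e y) (fieldIn_smul _ _ e y))

lemma fieldIn_indicator_eventuallyEq (hV : ContinuousAt (fieldIn V e) y)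
    (hVy : fieldIn V e y ≠ 0) (l : M → E) :
    fieldIn ((Function.support V).indicator l) e =ᶠ[𝓝 y] fieldIn l e := by
  filter_upwards [hV.eventually_ne hVy, e.open_target.mem_nhds hy] with z hVz hz
  rw [Ne, fieldIn_eq_zero_iff he hz] at hVz
  rw [fieldIn, Set.indicator_of_mem hVz]
  rfl

lemma fieldIn_indicator_eventuallyEq_zero (hV : ∀ᶠ z in 𝓝 y, fieldIn V e z = 0) (l : M → E) :
    fieldIn ((Function.support V).indicator l) e =ᶠ[𝓝 y] fun _ ↦ 0 := by
  filter_upwards [hV, e.open_target.mem_nhds hy] with z hVz hz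
  rw [fieldIn_eq_zero_iff he hz] at hVz ⊢
  exact Set.indicator_of_notMem (Function.notMem_support.2 hVz) l

end Target

lemma isParallelField_zero : IsParallelField G (fun _ : M ↦ (0 : E)) := by
  intro e _ y _
  have hzero : fieldIn (fun _ : M ↦ (0 : E)) e = fun _ ↦ 0 :=
    funext fun z ↦ map_zero (paramDeriv e z).inverse
  rw [hzero, cov_zero]

lemma IsConcircularField.exists_contMDiff_cov_eq [FiniteDimensional ℝ E] [Nontrivial E]
    [IsManifold 𝓘(ℝ, E) ∞ M] (hV : IsConcircularField G V) (hG : IsMetricField G) :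
    ∃ ρ : M → ℝ, ContMDiff 𝓘(ℝ, E) 𝓘(ℝ, ℝ) ∞ ρ ∧ ∀ e ∈ maximalAtlas 𝓘(ℝ, E) ∞ M,
      ∀ y ∈ e.target, cov (formIn G e) (fieldIn V e) y = ρ (e.symm y) • .id ℝ E := by
  have hex (x : M) : ∃ r : ℝ, ∀ e ∈ maximalAtlas 𝓘(ℝ, E) ∞ M, ∀ y ∈ e.target, e.symm y = x →
      cov (formIn G e) (fieldIn V e) y = r • .id ℝ E := by
    obtain ⟨e₀, he₀, y₀, hy₀, rfl⟩ := exists_mem_target (E := E) x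
    obtain ⟨r, hr⟩ := hV.exists_cov_eq e₀ he₀ y₀ hy₀
    refine ⟨r, fun e he y hy hyy₀ ↦ ?_⟩
    have hcov := cov_fieldIn_transition he₀ he hy₀ (hyy₀ ▸ e.map_target hy) hG hV.contDiffOn r hr
    rwa [← hyy₀, e.right_inv hy] at hcov
  choose ρ hρ using hex
  refine ⟨ρ, contMDiff_of_contDiffOn_comp_symm fun e he ↦ ?_, fun e he y hy ↦ hρ _ e he y hy rfl⟩
  obtain ⟨v, hv⟩ := exists_ne (0 : E)
  obtain ⟨ℓ, hℓ⟩ := SeparatingDual.exists_eq_one (R := ℝ) hv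
  have hcov : ContDiffOn ℝ ∞ (fun z ↦ ℓ (cov (formIn G e) (fieldIn V e) z v)) e.target :=
    fun y hy ↦ (ℓ.contDiff.contDiffAt.comp y
      (((hG e he).contDiffAt_cov hy (hV.contDiffAt he hy)).clm_apply
        contDiffAt_const)).contDiffWithinAt
  refine hcov.congr fun y hy ↦ ?_
  rw [hρ _ e he y hy rfl, smul_apply, ContinuousLinearMap.id_apply, map_smul, hℓ, smul_eq_mul,
    mul_one]

namespace IsSinyukovPair

variable [FiniteDimensional ℝ E] (ha : IsSinyukovPair G a l) (hG : IsMetricField G)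
  (hGexc : IsExceptionalMetric G)

include ha hG hGexc

lemma isConcircularField_indicator (hV : IsConcircularField G V) :
    IsConcircularField G ((Function.support V).indicator l) := by
  refine isConcircularField_of_eventuallyEq fun e he y hy ↦ ?_
  by_cases hVy : fieldIn V e y = 0
  · have hzero := (hG e he).eventually_eq_zero_of_cov_eq_zero hy
      (fun z hz ↦ hV.differentiableAt he hz) (hGexc V hV e he) hVy
    refine ⟨_, fieldIn_indicator_eventuallyEq_zero he hy hzero l, contDiffAt_const, 0, ?_⟩
    rw [cov_zero, zero_smul]
  · obtain ⟨r, hr⟩ := (ha e he).exists_cov_eq_smul (hG e he) hy (hV.contDiffAt he hy)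
      (hGexc V hV e he) hVy
    exact ⟨_, fieldIn_indicator_eventuallyEq he hy (hV.contDiffAt he hy).continuousAt hVy l,
      (ha e he).contDiffAt_grad y hy, r, ContinuousLinearMap.ext hr⟩

section Step

variable {k : ℕ}
  (hk : ∀ i < k, ∀ W, IsConcircularField G W → ∀ x, G x ((a x ^ i) (W x)) (l x) = 0)

include hk

lemma cov_fieldIn_combinedField (hV : IsConcircularField G V)
    (he : e ∈ maximalAtlas 𝓘(ℝ, E) ∞ M) (hy : y ∈ e.target) :
    cov (formIn G e) (fieldIn (fun x ↦ combinedField (G x) (a x) (l x) (V x) k) e) y =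
      (2 * G (e.symm y) ((a (e.symm y) ^ k) (V (e.symm y))) (l (e.symm y)) *
        G (e.symm y) (V (e.symm y)) (l (e.symm y))) • .id ℝ E := by
  have hcombined : fieldIn (fun x ↦ combinedField (G x) (a x) (l x) (V x) k) e =ᶠ[𝓝 y]
      fun z ↦ combinedField (formIn G e z) (endoIn a e z) (fieldIn l e z) (fieldIn V e z) k := by
    filter_upwards [e.open_target.mem_nhds hy] with z hz
    exact fieldIn_combinedField he hz G a l V k
  ext1 v
  rw [cov_congr hcombined, (ha e he).cov_combinedField (hG e he) hy (hV.differentiableAt he hy)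
    (hGexc V hV e he y hy), formIn_pow_apply_fieldIn he hy, formIn_apply_fieldIn he hy]
  · rfl
  · intro i hi
    rw [formIn_pow_apply_fieldIn he hy]
    exact hk i hi V hV _
  · intro hVy
    have hl := ha.isConcircularField_indicator hG hGexc hV
    have hindicator :=
      fieldIn_indicator_eventuallyEq he hy (hV.contDiffAt he hy).continuousAt hVy l
    refine ⟨(cov_congr hindicator).symm.trans (hGexc _ hl e he y hy), fun i hi ↦ ?_⟩
    have hstep := hk i hi _ hl (e.symm y)
    rwa [← formIn_pow_apply_fieldIn he hy, hindicator.self_of_nhds] at hstep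

lemma isConcircularField_combinedField (hV : IsConcircularField G V) :
    IsConcircularField G (fun x ↦ combinedField (G x) (a x) (l x) (V x) k) where
  contDiffOn e he := by
    refine ContDiffOn.congr (fun y hy ↦ ContDiffAt.contDiffWithinAt ?_)
      fun y hy ↦ fieldIn_combinedField he hy G a l V k
    have hGy := (hG e he).contDiffAt hy
    have hay := (ha e he).contDiffAt_endo y hy
    have hly := (ha e he).contDiffAt_grad y hy
    have hVy := hV.contDiffAt he hy
    have hpow (i : ℕ) := hGy.clm_apply ((hay.pow i).clm_apply hVy)
    exact ((contDiffAt_const.mul ((hpow k).clm_apply hly)).smul (hay.clm_apply hVy)).sub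
      (((hpow (k + 1)).clm_apply hVy).smul hly)
  exists_cov_eq e he y hy := ⟨_, ha.cov_fieldIn_combinedField hG hGexc hk hV he hy⟩

end Step

lemma apply_pow_eq_zero [IsManifold 𝓘(ℝ, E) ∞ M] (k : ℕ) :
    ∀ V, IsConcircularField G V → ∀ x, G x ((a x ^ k) (V x)) (l x) = 0 := by
  induction k using Nat.strong_induction_on with
  | _ k hk =>
    intro V hV x
    by_cases hVx : V x = 0
    · simp only [hVx, map_zero, zero_apply]
    have hcombined := ha.isConcircularField_combinedField hG hGexc hk hV
    obtain _ | k := k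
    · obtain ⟨e, he, y, hy, rfl⟩ := exists_mem_target (E := E) x
      have hcov := ha.cov_fieldIn_combinedField hG hGexc hk hV he hy
      rw [hGexc _ hcombined e he y hy] at hcov
      have hVy : fieldIn V e y ≠ 0 := (fieldIn_eq_zero_iff he hy).not.2 hVx
      have hsq := (smul_eq_zero.1 (DFunLike.congr_fun hcov (fieldIn V e y)).symm).resolve_right hVy
      rw [pow_zero, one_apply_eq_self] at hsq ⊢
      nlinarith
    · have hl := hk k (by lia) _ (ha.isConcircularField_indicator hG hGexc hV) x
      have hχ := hk k (by lia) _ hcombined x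
      rw [Set.indicator_of_mem (Function.mem_support.2 hVx)] at hl
      simp only [combinedField, map_sub, map_smul, sub_apply, smul_apply, smul_eq_mul, hl,
        ← mul_apply_eq_comp, ← pow_succ, mul_zero, sub_zero] at hχ
      nlinarith

end IsSinyukovPair

end Concircular

section Projective

variable {E : Type*} [NormedAddCommGroup E] [NormedSpace ℝ E] {M : Type*}
  {G H : M → E →L[ℝ] E →L[ℝ] ℝ} {V : M → E}

/-- The correspondence between the concircular fields of two projectively related metrics `G`
and `H`. -/
def scaledField (G H : M → E →L[ℝ] E →L[ℝ] ℝ) (V : M → E) (x : M) : E :=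
  (√(sinyukovScale (G x) (H x)))⁻¹ • V x

lemma scaledField_ne_zero {x : M} (hV : V x ≠ 0) : scaledField G H V x ≠ 0 :=
  smul_ne_zero (inv_ne_zero (Real.sqrt_pos.2 (sinyukovScale_pos _ _)).ne') hV

variable [TopologicalSpace M] [ChartedSpace E M] {e : OpenPartialHomeomorph M E} {y : E}

/-- Two metrics on `M` whose Levi-Civita connections are, at every point, in projective
difference. -/
def IsProjectivelyRelated (G H : M → E →L[ℝ] E →L[ℝ] ℝ) : Prop :=
  ∀ e ∈ maximalAtlas 𝓘(ℝ, E) ∞ M, ∀ y ∈ e.target,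
    ∃ ψ, IsProjectiveDifferenceAt (formIn G e) (formIn H e) y ψ

/-- The gradient of a function on `M` with respect to the metric `G`. -/
def gradient (G : M → E →L[ℝ] E →L[ℝ] ℝ) (F : M → ℝ) (x : M) : E := (G x).inverse (dFun F x)

lemma IsProjectivelyRelated.symm (hGH : IsProjectivelyRelated G H) : IsProjectivelyRelated H G := by
  intro e he y hy
  obtain ⟨ψ, hψ⟩ := hGH e he y hy
  exact ⟨-ψ, hψ.symm⟩

variable [FiniteDimensional ℝ E]

section Target

variable (he : e ∈ maximalAtlas 𝓘(ℝ, E) ∞ M) (hy : y ∈ e.target)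

include he hy

lemma sinyukovScale_formIn (hH : IsMetricForm (H (e.symm y))) :
    sinyukovScale (formIn G e y) (formIn H e y) = sinyukovScale (G (e.symm y)) (H (e.symm y)) :=
  sinyukovScale_bilinearComp hH (isInvertible_paramDeriv he hy)

lemma endoIn_sinyukovEndo (hH : IsMetricForm (H (e.symm y))) :
    endoIn (fun x ↦ sinyukovEndo (G x) (H x)) e y = sinyukovEndo (formIn G e y) (formIn H e y) := by
  ext x
  rw [endoIn, ContinuousLinearMap.comp_apply, ContinuousLinearMap.comp_apply,
    ← map_sinyukovEndo_bilinearComp hH (isInvertible_paramDeriv he hy)]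
  exact (isInvertible_paramDeriv he hy).inverse_apply_self _

lemma sinyukovPotential_formIn (hH : IsMetricForm (H (e.symm y))) :
    sinyukovPotential (formIn G e y) (formIn H e y) =
      sinyukovPotential (G (e.symm y)) (H (e.symm y)) := by
  rw [sinyukovPotential, ← endoIn_sinyukovEndo he hy hH, endoIn, traceL_comp_comm,
    ContinuousLinearMap.comp_assoc, (isInvertible_paramDeriv he hy).self_comp_inverse,
    ContinuousLinearMap.comp_id]
  rfl

lemma fieldIn_gradient (hG : IsMetricForm (G (e.symm y))) {F : M → ℝ}
    (hF : MDifferentiableAt 𝓘(ℝ, E) 𝓘(ℝ, ℝ) F (e.symm y)) :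
    fieldIn (gradient G F) e y = (formIn G e y).inverse (fderiv ℝ (fun z ↦ F (e.symm z)) y) := by
  have hform : IsMetricForm (formIn G e y) := hG.bilinearComp (isInvertible_paramDeriv he hy)
  refine hform.ext fun w ↦ ?_
  rw [hform.apply_inverse, fderiv_comp_symm he hy hF, ContinuousLinearMap.comp_apply,
    ← hG.apply_inverse (dFun F (e.symm y))]
  exact congrArg (G (e.symm y) · (paramDeriv e y w)) (paramDeriv_fieldIn he hy (gradient G F))

end Target

variable [IsManifold 𝓘(ℝ, E) ∞ M]

lemma scaledField_scaledField (hG : IsMetricField G) (hH : IsMetricField H) :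
    scaledField H G (scaledField G H V) = V := by
  ext1 x
  have hs : √(sinyukovScale (G x) (H x)) ≠ 0 := (Real.sqrt_pos.2 (sinyukovScale_pos _ _)).ne'
  rw [scaledField, scaledField, sinyukovScale_symm (hG.isMetricForm x) (hH.isMetricForm x),
    Real.sqrt_inv, inv_inv, smul_inv_smul₀ hs]

lemma fieldIn_scaledField_eventuallyEq (hH : IsMetricField H) (V : M → E)
    (he : e ∈ maximalAtlas 𝓘(ℝ, E) ∞ M) (hy : y ∈ e.target) :
    fieldIn (scaledField G H V) e =ᶠ[𝓝 y]
      fun z ↦ (√(sinyukovScale (formIn G e z) (formIn H e z)))⁻¹ • fieldIn V e z := by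
  filter_upwards [e.open_target.mem_nhds hy] with z hz
  rw [sinyukovScale_formIn he hz (hH.isMetricForm _)]
  exact fieldIn_smul _ V e z

variable (hG : IsMetricField G) (hH : IsMetricField H)

include hG hH

lemma contMDiff_sinyukovPotential :
    ContMDiff 𝓘(ℝ, E) 𝓘(ℝ, ℝ) ∞ (fun x ↦ sinyukovPotential (G x) (H x)) :=
  contMDiff_of_contDiffOn_comp_symm fun e he ↦ ContDiffOn.congr
    (fun _ hy ↦ (contDiffAt_sinyukovPotential (hG e he) (hH e he) hy).contDiffWithinAt)
    fun _ hy ↦ (sinyukovPotential_formIn he hy (hH.isMetricForm _)).symm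

lemma fieldIn_gradient_sinyukovPotential (he : e ∈ maximalAtlas 𝓘(ℝ, E) ∞ M) (hy : y ∈ e.target) :
    fieldIn (gradient G fun x ↦ sinyukovPotential (G x) (H x)) e y =
      sinyukovGrad (formIn G e) (formIn H e) y := by
  have hpotential : (fun z ↦ sinyukovPotential (formIn G e z) (formIn H e z)) =ᶠ[𝓝 y]
      fun z ↦ sinyukovPotential (G (e.symm z)) (H (e.symm z)) := by
    filter_upwards [e.open_target.mem_nhds hy] with z hz
    exact sinyukovPotential_formIn he hz (hH.isMetricForm _)
  rw [sinyukovGrad, hpotential.fderiv_eq]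
  exact fieldIn_gradient he hy (hG.isMetricForm _)
    ((contMDiff_sinyukovPotential hG hH).mdifferentiable (by simp) _)

variable (hGH : IsProjectivelyRelated G H)

include hGH

lemma isSinyukovPair_sinyukovEndo : IsSinyukovPair G (fun x ↦ sinyukovEndo (G x) (H x))
    (gradient G fun x ↦ sinyukovPotential (G x) (H x)) := fun e he ↦
  (isSinyukovSolution_sinyukovEndo (hG e he) (hH e he) (hGH e he)).congr (hG e he).isOpen
    (fun _ hy ↦ (endoIn_sinyukovEndo he hy (hH.isMetricForm _)).symm)
    fun _ hy ↦ (fieldIn_gradient_sinyukovPotential hG hH he hy).symm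

lemma isConcircularField_scaledField (hV : IsConcircularField G V) :
    IsConcircularField H (scaledField G H V) := by
  refine isConcircularField_of_eventuallyEq fun e he y hy ↦
    ⟨_, fieldIn_scaledField_eventuallyEq hH V he hy,
      ((contDiffAt_sqrt_sinyukovScale (hG e he) (hH e he) hy).inv ?_).smul (hV.contDiffAt he hy),
      ?_⟩
  · exact (Real.sqrt_pos.2 (sinyukovScale_pos _ _)).ne'
  · obtain ⟨ψ, hψ⟩ := hGH e he y hy
    obtain ⟨r, hr⟩ := hV.exists_cov_eq e he y hy
    refine ⟨(√(sinyukovScale (formIn G e y) (formIn H e y)))⁻¹ * (r + ψ (fieldIn V e y)), ?_⟩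
    rw [cov_inv_sqrt_sinyukovScale_smul (hG e he) (hH e he) hy hψ (hV.differentiableAt he hy), hr,
      ← add_smul, smul_smul]

lemma IsExceptionalMetric.apply_fieldIn_eq_zero (hGexc : IsExceptionalMetric G)
    (hV : IsConcircularField G V) (he : e ∈ maximalAtlas 𝓘(ℝ, E) ∞ M) (hy : y ∈ e.target)
    {ψ : E →L[ℝ] ℝ} (hψ : IsProjectiveDifferenceAt (formIn G e) (formIn H e) y ψ) :
    ψ (fieldIn V e y) = 0 := by
  have hGy := (hG e he).isMetricForm y hy
  have hHy := (hH e he).isMetricForm y hy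
  refine apply_eq_zero_of_pow_succ (sinyukovEndo_injective hGy hHy) fun k ↦ ?_
  have hpow := (isSinyukovPair_sinyukovEndo hG hH hGH).apply_pow_eq_zero hG hGexc k V hV (e.symm y)
  rw [pow_succ_apply, apply_sinyukovEndo_eq_neg (hG e he) (hH e he) hy hψ, hGy.symm,
    ← fieldIn_gradient_sinyukovPotential hG hH he hy,
    ← endoIn_sinyukovEndo he hy (hH.isMetricForm _), formIn_pow_apply_fieldIn he hy, hpow, neg_zero]

lemma IsExceptionalMetric.of_isProjectivelyRelated (hGexc : IsExceptionalMetric G) :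
    IsExceptionalMetric H := by
  intro W hW e he y hy
  have hV := isConcircularField_scaledField hH hG hGH.symm hW
  obtain ⟨ψ, hψ⟩ := hGH e he y hy
  have hψV := hGexc.apply_fieldIn_eq_zero hG hH hGH hV he hy hψ
  have hW_eq := fieldIn_scaledField_eventuallyEq (G := G) hH (scaledField H G W) he hy
  rw [scaledField_scaledField hH hG] at hW_eq
  rw [cov_congr hW_eq, cov_inv_sqrt_sinyukovScale_smul (hG e he) (hH e he) hy hψ
    (hV.differentiableAt he hy), hGexc _ hV e he y hy, hψV, zero_smul, add_zero, smul_zero]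

end Projective

/-! ### Transport along a diffeomorphism -/

section Pullback

variable {E : Type*} [NormedAddCommGroup E] [NormedSpace ℝ E] {M : Type*} [TopologicalSpace M]
  [ChartedSpace E M] {N : Type*} [TopologicalSpace N] [ChartedSpace E N]

/-- The differential of a map at a point, as an endomorphism of the model space. -/
def dMap (f : M → N) (x : M) : E →L[ℝ] E :=
  mfderiv 𝓘(ℝ, E) 𝓘(ℝ, E) f x

/-- The pullback along `f` of a field of bilinear forms. -/
def pullForm (f : M → N) (B : N → E →L[ℝ] E →L[ℝ] ℝ) (x : M) : E →L[ℝ] E →L[ℝ] ℝ :=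
  (B (f x)).bilinearComp (dMap f x) (dMap f x)

/-- The pullback along `f` of a vector field. -/
def pullField (f : M → N) (V : N → E) (x : M) : E :=
  (dMap f x).inverse (V (f x))

/-- The chart of `N` which a chart of `M` becomes under the diffeomorphism `f : M → N`. -/
def pushChart (f : M ≃ₘ^∞⟮𝓘(ℝ, E), 𝓘(ℝ, E)⟯ N) (e : OpenPartialHomeomorph M E) :
    OpenPartialHomeomorph N E :=
  f.symm.toHomeomorph.transOpenPartialHomeomorph e

variable (f : M ≃ₘ^∞⟮𝓘(ℝ, E), 𝓘(ℝ, E)⟯ N) {B : N → E →L[ℝ] E →L[ℝ] ℝ} {V : N → E}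
  {e : OpenPartialHomeomorph M E} {y : E}

lemma dMap_comp_dMap_symm (x : N) :
    (dMap (E := E) f (f.symm x)).comp (dMap (E := E) f.symm x) = .id ℝ E := by
  have hcomp := (f.mdifferentiable (by simp) (f.symm x)).hasMFDerivAt.comp x
    (f.symm.mdifferentiable (by simp) x).hasMFDerivAt
  rw [show f ∘ f.symm = id from funext f.apply_symm_apply] at hcomp
  exact hasMFDerivAt_unique hcomp (hasMFDerivAt_id x)

lemma isInvertible_dMap (x : M) : (dMap (E := E) f x).IsInvertible := by
  have hright := dMap_comp_dMap_symm f (f x)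
  rw [f.symm_apply_apply] at hright
  exact .of_inverse hright (dMap_comp_dMap_symm f.symm x)

lemma pullForm_symm_pullForm (B : N → E →L[ℝ] E →L[ℝ] ℝ) :
    pullForm f.symm (pullForm f B) = B := by
  ext x u v
  have hid (w : E) : dMap f (f.symm x) (dMap f.symm x w) = w :=
    DFunLike.congr_fun (dMap_comp_dMap_symm f x) w
  simp only [pullForm, ContinuousLinearMap.bilinearComp_apply, f.apply_symm_apply, hid]

lemma pullField_pullField_symm (V : M → E) : pullField f (pullField f.symm V) = V := by
  ext1 x
  rw [pullField, pullField, ← (isInvertible_dMap f x).inverse_comp_apply_of_right,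
    f.symm_apply_apply]
  have hid : (dMap (E := E) f.symm (f x)).comp (dMap f x) = .id ℝ E :=
    dMap_comp_dMap_symm f.symm x
  rw [hid, ContinuousLinearMap.inverse_id, ContinuousLinearMap.id_apply]

lemma pullField_ne_zero {x : N} (hV : V x ≠ 0) : pullField f V (f.symm x) ≠ 0 := by
  obtain ⟨L, hL⟩ := isInvertible_dMap f (f.symm x)
  rw [pullField, f.apply_symm_apply, ← hL, ContinuousLinearMap.inverse_equiv]
  exact fun h ↦ hV (L.symm.map_eq_zero_iff.1 h)

section Target

variable (he : e ∈ maximalAtlas 𝓘(ℝ, E) ∞ M) (hy : y ∈ e.target)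

include he hy

lemma paramDeriv_pushChart :
    paramDeriv (pushChart f e) y = (dMap f (e.symm y)).comp (paramDeriv e y) :=
  ((f.mdifferentiable (by simp) (e.symm y)).hasMFDerivAt.comp y
    ((mdifferentiable_of_mem_maximalAtlas he).mdifferentiableAt_symm hy).hasMFDerivAt).mfderiv

lemma formIn_pushChart (B : N → E →L[ℝ] E →L[ℝ] ℝ) :
    formIn B (pushChart f e) y = formIn (pullForm f B) e y := by
  rw [formIn, paramDeriv_pushChart f he hy]
  rfl

lemma fieldIn_pushChart (V : N → E) :
    fieldIn V (pushChart f e) y = fieldIn (pullField f V) e y := by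
  rw [fieldIn, paramDeriv_pushChart f he hy,
    (isInvertible_dMap f _).inverse_comp_apply_of_left]
  rfl

lemma formIn_pushChart_eventuallyEq (B : N → E →L[ℝ] E →L[ℝ] ℝ) :
    formIn B (pushChart f e) =ᶠ[𝓝 y] formIn (pullForm f B) e := by
  filter_upwards [e.open_target.mem_nhds hy] with z hz using formIn_pushChart f he hz B

lemma cov_pushChart (B : N → E →L[ℝ] E →L[ℝ] ℝ) (V : N → E) :
    cov (formIn B (pushChart f e)) (fieldIn V (pushChart f e)) y =
      cov (formIn (pullForm f B) e) (fieldIn (pullField f V) e) y := by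
  rw [cov, leviCivita_congr (formIn_pushChart_eventuallyEq f he hy B)]
  refine cov_congr ?_
  filter_upwards [e.open_target.mem_nhds hy] with z hz using fieldIn_pushChart f he hz V

end Target

variable [IsManifold 𝓘(ℝ, E) ∞ N]

lemma pushChart_mem_maximalAtlas (he : e ∈ maximalAtlas 𝓘(ℝ, E) ∞ M) :
    pushChart f e ∈ maximalAtlas 𝓘(ℝ, E) ∞ N :=
  (pushChart f e).mem_maximalAtlas_of_contMDiffOn
    ((contMDiffOn_of_mem_maximalAtlas he).comp f.symm.contMDiff.contMDiffOn fun _ hx ↦ hx)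
    (f.contMDiff.comp_contMDiffOn (contMDiffOn_symm_of_mem_maximalAtlas he))

lemma IsMetricField.pullForm (hB : IsMetricField B) : IsMetricField (pullForm f B) := by
  intro e he
  have hpush := hB _ (pushChart_mem_maximalAtlas f he)
  exact
    { isOpen := e.open_target
      contDiffOn := hpush.contDiffOn.congr fun y hy ↦ (formIn_pushChart f he hy B).symm
      isMetricForm := fun y hy ↦ formIn_pushChart f he hy B ▸ hpush.isMetricForm y hy }

lemma IsConcircularField.pullField (hV : IsConcircularField B V) :
    IsConcircularField (pullForm f B) (pullField f V) where
  contDiffOn e he := (hV.contDiffOn _ (pushChart_mem_maximalAtlas f he)).congr fun _ hy ↦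
    (fieldIn_pushChart f he hy V).symm
  exists_cov_eq e he y hy := by
    rw [← cov_pushChart f he hy]
    exact hV.exists_cov_eq _ (pushChart_mem_maximalAtlas f he) y hy

lemma IsParallelField.pullField (hV : IsParallelField B V) :
    IsParallelField (pullForm f B) (pullField f V) := fun _ he y hy ↦
  (cov_pushChart f he hy B V).symm.trans (hV _ (pushChart_mem_maximalAtlas f he) y hy)

lemma IsExceptionalMetric.pullForm [IsManifold 𝓘(ℝ, E) ∞ M] (hB : IsExceptionalMetric B) :
    IsExceptionalMetric (pullForm f B) := by
  intro V hV
  have hconcircular := hV.pullField f.symm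
  rw [pullForm_symm_pullForm] at hconcircular
  have hparallel := (hB _ hconcircular).pullField f
  rwa [pullField_pullField_symm] at hparallel

end Pullback

/-! ### Pseudo-Riemannian metrics in charts -/

section Metric

variable {n : ℕ} {M : Type*} [TopologicalSpace M] [ChartedSpace (EuclideanSpace ℝ (Fin n)) M]
  [IsManifold (𝓡 n) ∞ M] {e : OpenPartialHomeomorph M (EuclideanSpace ℝ (Fin n))}
  {y : EuclideanSpace ℝ (Fin n)} {V : M → EuclideanSpace ℝ (Fin n)}

/-- The bilinear form of a metric at a point, read on the model space, which every tangent space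
is by definition. -/
def formAt (g : PseudoRiemannianMetric n M) (x : M) :
    EuclideanSpace ℝ (Fin n) →L[ℝ] EuclideanSpace ℝ (Fin n) →L[ℝ] ℝ :=
  g.form x

variable (g : PseudoRiemannianMetric n M)

lemma contDiffOn_formIn_formAt (he : e ∈ maximalAtlas (𝓡 n) ∞ M) :
    ContDiffOn ℝ ∞ (formIn (formAt g) e) e.target := by
  refine contDiffOn_clm_apply.2 fun u ↦ contDiffOn_clm_apply.2 fun v ↦ ?_
  have hbundle : ContMDiffOn (𝓡 n) ((𝓡 n).prod 𝓘(ℝ, ℝ)) ∞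
      (fun z ↦ Bundle.TotalSpace.mk' ℝ (E := Bundle.Trivial M ℝ) (e.symm z)
        (g.form (e.symm z) (paramDeriv e z u) (paramDeriv e z v))) e.target :=
    ContMDiffOn.clm_bundle_apply₂ (F₁ := EuclideanSpace ℝ (Fin n))
      (F₂ := EuclideanSpace ℝ (Fin n))
      (g.contMDiff.comp_contMDiffOn (contMDiffOn_symm_of_mem_maximalAtlas he))
      (contMDiffOn_paramDeriv he contDiffOn_const) (contMDiffOn_paramDeriv he contDiffOn_const)
  exact contMDiffOn_iff_contDiffOn.1 fun z hz ↦
    (Bundle.contMDiffWithinAt_totalSpace.1 (hbundle z hz)).2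

lemma isMetricField_formAt : IsMetricField (formAt g) := fun e he ↦
  { isOpen := e.open_target
    contDiffOn := contDiffOn_formIn_formAt g he
    isMetricForm := fun y hy ↦
      IsMetricForm.bilinearComp ⟨g.symm (e.symm y), g.nondegenerate (e.symm y)⟩
        (isInvertible_paramDeriv he hy) }

lemma fieldInChart_eq_fieldIn (V : M → EuclideanSpace ℝ (Fin n)) (p : M)
    (hy : y ∈ (chartAt (EuclideanSpace ℝ (Fin n)) p).target) :
    PseudoRiemannianMetric.fieldInChart V p y =
      fieldIn V (chartAt (EuclideanSpace ℝ (Fin n)) p) y :=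
  (fieldIn_eq_mfderiv (chart_mem_maximalAtlas p) hy V).symm

lemma covDeriv_eq_cov (V : M → EuclideanSpace ℝ (Fin n)) (x : M) (u : EuclideanSpace ℝ (Fin n)) :
    g.covDeriv V x u = cov (formIn (formAt g) (chartAt (EuclideanSpace ℝ (Fin n)) x))
      (fieldIn V (chartAt (EuclideanSpace ℝ (Fin n)) x))
      (chartAt (EuclideanSpace ℝ (Fin n)) x x) u := by
  have hev : PseudoRiemannianMetric.fieldInChart V x
      =ᶠ[𝓝 (chartAt (EuclideanSpace ℝ (Fin n)) x x)]
        fieldIn V (chartAt (EuclideanSpace ℝ (Fin n)) x) := by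
    filter_upwards [(chartAt (EuclideanSpace ℝ (Fin n)) x).open_target.mem_nhds
      (mem_chart_target _ x)] with z hz using fieldInChart_eq_fieldIn V x hz
  rw [cov_apply, ← hev.fderiv_eq, fieldIn_chartAt_self]
  rfl

lemma form_covDeriv_eq_mul_iff_chartAt (x : M) (r : ℝ) :
    (∀ X Y : TangentSpace (𝓡 n) x, g.form x (g.covDeriv V x Y) X = r * g.form x X Y) ↔
      cov (formIn (formAt g) (chartAt _ x)) (fieldIn V (chartAt _ x)) (chartAt _ x x) =
        r • .id ℝ (EuclideanSpace ℝ (Fin n)) := by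
  have hform : IsMetricForm (formAt g x) := (isMetricField_formAt g).isMetricForm x
  constructor
  · intro h
    ext1 u
    refine hform.ext fun w ↦ ?_
    rw [← covDeriv_eq_cov, smul_apply, ContinuousLinearMap.id_apply, map_smul, smul_apply,
      smul_eq_mul, hform.symm u w]
    exact h w u
  · intro h X Y
    have hcov : g.covDeriv V x Y = r • (Y : EuclideanSpace ℝ (Fin n)) :=
      (covDeriv_eq_cov g V x Y).trans (DFunLike.congr_fun h Y)
    exact (congrArg (formAt g x · X) hcov).trans <| (hform.symm _ X).trans <|
      map_smul (formAt g x X) r Y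

lemma form_covDeriv_eq_mul_iff (he : e ∈ maximalAtlas (𝓡 n) ∞ M) (hy : y ∈ e.target)
    (hV : ∀ e ∈ maximalAtlas (𝓡 n) ∞ M, ContDiffOn ℝ ∞ (fieldIn V e) e.target) (r : ℝ) :
    (∀ X Y : TangentSpace (𝓡 n) (e.symm y),
      g.form (e.symm y) (g.covDeriv V (e.symm y) Y) X = r * g.form (e.symm y) X Y) ↔
      cov (formIn (formAt g) e) (fieldIn V e) y = r • .id ℝ _ := by
  set x := e.symm y with hx
  set e₀ := chartAt (EuclideanSpace ℝ (Fin n)) x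
  have he₀ : e₀ ∈ maximalAtlas (𝓡 n) ∞ M := chart_mem_maximalAtlas x
  have hx₀ : x ∈ e₀.source := mem_chart_source _ x
  have hsymm : e₀.symm (e₀ x) = x := e₀.left_inv hx₀
  rw [form_covDeriv_eq_mul_iff_chartAt]
  constructor <;> intro h
  · have hx' : e₀.symm (e₀ x) ∈ e.source := hsymm.symm ▸ hx ▸ e.map_target hy
    have hcov := cov_fieldIn_transition he₀ he (e₀.map_source hx₀) hx' (isMetricField_formAt g) hV
      r h
    rwa [hsymm, hx, e.right_inv hy] at hcov
  · exact cov_fieldIn_transition he he₀ hy hx₀ (isMetricField_formAt g) hV r h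

lemma isConcircular_iff {ρ : M → ℝ} : g.IsConcircular V ρ ↔
    (∀ e ∈ maximalAtlas (𝓡 n) ∞ M, ContDiffOn ℝ ∞ (fieldIn V e) e.target) ∧
      ContMDiff (𝓡 n) 𝓘(ℝ, ℝ) ∞ ρ ∧ ∀ e ∈ maximalAtlas (𝓡 n) ∞ M, ∀ y ∈ e.target,
        cov (formIn (formAt g) e) (fieldIn V e) y = ρ (e.symm y) • .id ℝ _ := by
  constructor
  · rintro ⟨hV, hρ, hcov⟩
    have hV_in : ∀ e ∈ maximalAtlas (𝓡 n) ∞ M, ContDiffOn ℝ ∞ (fieldIn V e) e.target :=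
      fun e he y hy ↦ (contDiffAt_fieldIn he hy hV.contMDiffAt).contDiffWithinAt
    exact ⟨hV_in, hρ, fun e he y hy ↦ (form_covDeriv_eq_mul_iff g he hy hV_in _).1 (hcov _)⟩
  · rintro ⟨hV, hρ, hcov⟩
    refine ⟨contMDiff_of_contDiffOn_fieldIn hV, hρ, fun x ↦ ?_⟩
    obtain ⟨e, he, y, hy, rfl⟩ := exists_mem_target (E := EuclideanSpace ℝ (Fin n)) x
    exact (form_covDeriv_eq_mul_iff g he hy hV _).2 (hcov e he y hy)

lemma isExceptionalEquidistant_iff : g.IsExceptionalEquidistant ↔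
    (∃ V, (∃ x, V x ≠ 0) ∧ IsConcircularField (formAt g) V) ∧ IsExceptionalMetric (formAt g) := by
  constructor
  · rintro ⟨⟨φ, ρ, ⟨x, hφx⟩, hφ⟩, hexc⟩
    have : Nontrivial (EuclideanSpace ℝ (Fin n)) := ⟨φ x, 0, hφx⟩
    obtain ⟨hφ_in, -, hcov⟩ := (isConcircular_iff g).1 hφ
    refine ⟨⟨φ, ⟨x, hφx⟩, hφ_in, fun e he y hy ↦ ⟨_, hcov e he y hy⟩⟩, fun V hV ↦ ?_⟩
    by_cases hV0 : ∃ x, V x ≠ 0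
    · obtain ⟨σ, hσ, hcovV⟩ := hV.exists_contMDiff_cov_eq (isMetricField_formAt g)
      intro e he y hy
      rw [hcovV e he y hy, hexc V σ hV0 ((isConcircular_iff g).2 ⟨hV.contDiffOn, hσ, hcovV⟩),
        zero_smul]
    · push Not at hV0
      exact funext hV0 ▸ isParallelField_zero
  · rintro ⟨⟨V, ⟨x, hVx⟩, hV⟩, hexc⟩
    have : Nontrivial (EuclideanSpace ℝ (Fin n)) := ⟨V x, 0, hVx⟩
    obtain ⟨ρ, hρ, hcov⟩ := hV.exists_contMDiff_cov_eq (isMetricField_formAt g)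
    refine ⟨⟨V, ρ, ⟨x, hVx⟩, (isConcircular_iff g).2 ⟨hV.contDiffOn, hρ, hcov⟩⟩, ?_⟩
    intro φ σ _ hφ x
    obtain ⟨hφ_in, -, hcovφ⟩ := (isConcircular_iff g).1 hφ
    obtain ⟨e, he, y, hy, rfl⟩ := exists_mem_target (E := EuclideanSpace ℝ (Fin n)) x
    have hzero := hexc φ ⟨hφ_in, fun e he y hy ↦ ⟨_, hcovφ e he y hy⟩⟩ e he y hy
    rw [hcovφ e he y hy] at hzero
    exact (smul_eq_zero.1 hzero).resolve_right one_ne_zero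

end Metric

/-! ### Geodesic mappings -/

section Pregeodesic

variable {E : Type*} [NormedAddCommGroup E] [NormedSpace ℝ E]

/-- The equation of a geodesic with an arbitrary parameter, at the time `t`: the curve `c` is
regular and its acceleration is proportional to its velocity. -/
def IsPregeodesicAt (G : E → E →L[ℝ] E →L[ℝ] ℝ) (c : ℝ → E) (t : ℝ) : Prop :=
  deriv c t ≠ 0 ∧
    ∃ θ : ℝ, deriv (deriv c) t + leviCivita G (c t) (deriv c t) (deriv c t) = θ • deriv c t

lemma IsIsometryAt.isPregeodesicAt_iff [FiniteDimensional ℝ E]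
    {G G' : E → E →L[ℝ] E →L[ℝ] ℝ} {τ : E → E} {c : ℝ → E} {t : ℝ} {Ω Ω' : Set E}
    (h : IsIsometryAt G G' τ (c t)) (hG : IsMetricOn G Ω) (hy : c t ∈ Ω) (hG' : IsMetricOn G' Ω')
    (hτy : τ (c t) ∈ Ω') (hc : ContDiffAt ℝ 2 c t) :
    IsPregeodesicAt G' (fun s ↦ τ (c s)) t ↔ IsPregeodesicAt G c t := by
  obtain ⟨hvelocity, hacceleration⟩ := h.map_acceleration hG hy hG' hτy hc
  have hinj := h.isInvertible.injective
  rw [IsPregeodesicAt, IsPregeodesicAt, hacceleration, hvelocity, map_ne_zero_iff _ hinj]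
  simp only [← map_smul, hinj.eq_iff]

end Pregeodesic

section GeodesicMapping

variable {n : ℕ} {M : Type*} [TopologicalSpace M] [ChartedSpace (EuclideanSpace ℝ (Fin n)) M]
  [IsManifold (𝓡 n) ∞ M]

lemma isGeodesicOn_symm_comp_iff (g : PseudoRiemannianMetric n M)
    {e : OpenPartialHomeomorph M (EuclideanSpace ℝ (Fin n))} (he : e ∈ maximalAtlas (𝓡 n) ∞ M)
    {c : ℝ → EuclideanSpace ℝ (Fin n)} {J : Set ℝ} (hJ : IsOpen J) (hc : ContDiffOn ℝ 2 c J)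
    (hcJ : ∀ t ∈ J, c t ∈ e.target) :
    g.IsGeodesicOn (fun t ↦ e.symm (c t)) J ↔
      ∀ t ∈ J, IsPregeodesicAt (formIn (formAt g) e) c t := by
  have hsmooth : ContMDiffOn 𝓘(ℝ, ℝ) (𝓡 n) 2 (fun t ↦ e.symm (c t)) J :=
    ((contMDiffOn_symm_of_mem_maximalAtlas he).of_le (by norm_cast)).comp
      hc.contMDiffOn hcJ
  rw [PseudoRiemannianMetric.IsGeodesicOn, and_iff_right hsmooth]
  refine forall₂_congr fun t ht ↦ ?_
  have he₀ := chart_mem_maximalAtlas (I := 𝓡 n) (n := ∞) (e.symm (c t))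
  have hsource := mem_chart_source (EuclideanSpace ℝ (Fin n)) (e.symm (c t))
  exact (isIsometryAt_transition he he₀ (hcJ t ht) hsource (formAt g)).isPregeodesicAt_iff
    (isMetricField_formAt g e he) (hcJ t ht) (isMetricField_formAt g _ he₀)
    ((chartAt _ _).map_source hsource) (hc.contDiffAt (hJ.mem_nhds ht))

variable {N : Type*} [TopologicalSpace N] [ChartedSpace (EuclideanSpace ℝ (Fin n)) N]
  [IsManifold (𝓡 n) ∞ N] {g : PseudoRiemannianMetric n M} {g' : PseudoRiemannianMetric n N}
  {f : M ≃ₘ^∞⟮𝓡 n, 𝓡 n⟯ N}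

lemma exists_leviCivita_sub_apply_self_eq_smul (hf : g.IsGeodesicMapping g' f)
    {e : OpenPartialHomeomorph M (EuclideanSpace ℝ (Fin n))} (he : e ∈ maximalAtlas (𝓡 n) ∞ M)
    {y : EuclideanSpace ℝ (Fin n)} (hy : y ∈ e.target) (v : EuclideanSpace ℝ (Fin n)) :
    ∃ θ : ℝ, (leviCivita (formIn (formAt g') (pushChart f e)) y -
      leviCivita (formIn (formAt g) e) y) v v = θ • v := by
  obtain rfl | hv := eq_or_ne v 0
  · exact ⟨0, by simp⟩
  obtain ⟨c, rfl, rfl, ε, hε, hc, hgeod⟩ := (isMetricField_formAt g e he).exists_geodesic hy hv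
  have hcJ : ∀ t ∈ Set.Ioo (-ε) ε, c t ∈ e.target := fun t ht ↦ (hgeod t ht).1
  have h0 : (0 : ℝ) ∈ Set.Ioo (-ε) ε := ⟨neg_lt_zero.2 hε, hε⟩
  have hsource : g.IsGeodesicOn (fun t ↦ e.symm (c t)) (Set.Ioo (-ε) ε) :=
    (isGeodesicOn_symm_comp_iff g he isOpen_Ioo hc hcJ).2 fun t ht ↦
      ⟨(hgeod t ht).2.1, 0, by rw [(hgeod t ht).2.2, zero_smul]⟩
  have htarget := hf _ _ isOpen_Ioo Set.ordConnected_Ioo hsource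
  obtain ⟨-, θ, hθ⟩ := (isGeodesicOn_symm_comp_iff g' (pushChart_mem_maximalAtlas f he) isOpen_Ioo
    hc hcJ).1 htarget 0 h0
  refine ⟨θ, ?_⟩
  rw [sub_apply, sub_apply, ← hθ, eq_neg_of_add_eq_zero_left (hgeod 0 h0).2.2]
  abel

lemma isProjectivelyRelated_of_isGeodesicMapping (hf : g.IsGeodesicMapping g' f) :
    IsProjectivelyRelated (formAt g) (pullForm f (formAt g')) := by
  intro e he y hy
  have hmetric := isMetricField_formAt g e he
  have hmetric' := isMetricField_formAt g' _ (pushChart_mem_maximalAtlas f he)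
  obtain ⟨ψ, hψ⟩ := exists_eq_smul_add_smul
    (fun u v ↦ congrArg₂ (· - ·) (hmetric'.leviCivita_symm hy u v) (hmetric.leviCivita_symm hy u v))
    (exists_leviCivita_sub_apply_self_eq_smul hf he hy)
  refine ⟨ψ, fun u v ↦ ?_⟩
  rw [← leviCivita_congr (formIn_pushChart_eventuallyEq f he hy (formAt g')), add_assoc, ← hψ]
  exact (add_sub_cancel _ _).symm

end GeodesicMapping

end GeodesicMapping

open GeodesicMapping in
theorem corollary3_general {n : ℕ}
    {M : Type*} [TopologicalSpace M]
    [ChartedSpace (EuclideanSpace ℝ (Fin n)) M] [IsManifold (𝓡 n) ∞ M]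
    {N : Type*} [TopologicalSpace N]
    [ChartedSpace (EuclideanSpace ℝ (Fin n)) N] [IsManifold (𝓡 n) ∞ N]
    (g : PseudoRiemannianMetric n M) (g' : PseudoRiemannianMetric n N)
    (hg : g.IsExceptionalEquidistant)
    (hmap : ∃ f : M ≃ₘ^∞⟮𝓡 n, 𝓡 n⟯ N, g.IsGeodesicMapping g' f) :
    g'.IsExceptionalEquidistant := by
  obtain ⟨f, hf⟩ := hmap
  obtain ⟨⟨V, ⟨x, hVx⟩, hV⟩, hexc⟩ := (isExceptionalEquidistant_iff g).1 hg
  have hG := isMetricField_formAt g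
  have hH := (isMetricField_formAt g').pullForm f
  have hGH := isProjectivelyRelated_of_isGeodesicMapping hf
  have hW := (isConcircularField_scaledField hG hH hGH hV).pullField f.symm
  have hexc' := (hexc.of_isProjectivelyRelated hG hH hGH).pullForm f.symm
  rw [pullForm_symm_pullForm] at hW hexc'
  exact (isExceptionalEquidistant_iff g').2
    ⟨⟨_, ⟨f x, pullField_ne_zero f.symm (scaledField_ne_zero hVx)⟩, hW⟩, hexc'⟩

end

theorem corollary3 {n : ℕ}
    {M : Type*} [TopologicalSpace M] [T2Space M] [SecondCountableTopology M]
    [ChartedSpace (EuclideanSpace ℝ (Fin n)) M] [IsManifold (𝓡 n) ∞ M]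
    {N : Type*} [TopologicalSpace N] [T2Space N] [SecondCountableTopology N]
    [ChartedSpace (EuclideanSpace ℝ (Fin n)) N] [IsManifold (𝓡 n) ∞ N]
    (g : PseudoRiemannianMetric n M) (g' : PseudoRiemannianMetric n N)
    (hg : g.IsExceptionalEquidistant)
    (hmap : ∃ f : M ≃ₘ^∞⟮𝓡 n, 𝓡 n⟯ N, g.IsGeodesicMapping g' f) :
    g'.IsExceptionalEquidistant := by
  exact corollary3_general g g' hg hmap
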